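/- Let $d\ge 1$, $m\ge 0$, $0<\alpha<2$, $v>0$ and $a>0$. Let $L_{m,\alpha}=(-\Delta+m^{2/\alpha})^{\alpha/2}-m$ be the self-adjoint operator on $L^2(\mathbb R^d)$ given by the Fourier multiplier $(|y|^2+m^{2/\alpha})^{\alpha/2}-m$ (that is, $|y|^\alpha$ if $m=0$), with domain $\{f\in L^2(\mathbb R^d): ((|\cdot|^2+m^{2/\alpha})^{\alpha/2}-m)\hat f\in L^2(\mathbb R^d)\}$, and let $$H_{m,\alpha}=L_{m,\alpha}-v\,\mathbf 1_{\mathcal B_a},\qquad \mathcal B_a=\{x\in\mathbb R^d:|x|<a\},$$ with the same domain. Suppose that $H_{m,\alpha}$ has a ground state $\varphi_0$, i.e. a non-zero $\varphi_0$ in the domain of $H_{m,\alpha}$ with $H_{m,\alpha}\varphi_0=\lambda_0\varphi_0$, where $\lambda_0=\inf\operatorname{Spec}H_{m,\alpha}$. Then the following hold for every function $\mathbb R^d\to\mathbb C$ that represents $\varphi_0$ (in particular for its continuous, strictly positive version), denoted again by $\varphi_0$: 1. If $\alpha\in(0,1)$, then $\varphi_0\notin C^{\alpha+\delta}_{\rm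 loc}(\mathbb R^d)$ for every $\delta\in(0,1-\alpha)$. 2. If $\alpha\in[1,2)$, then $\varphi_0\notin C^{1,\alpha+\delta-1}_{\rm loc}(\mathbb R^d)$ for every $\delta\in(0,2-\alpha)$. Here, for $\gamma\in(0,1)$, $C^{\gamma}_{\rm loc}(\mathbb R^d)$ is the set of functions that are Hölder continuous with exponent $\gamma$ on every compact subset of $\mathbb R^d$, and $C^{1,\gamma}_{\rm loc}(\mathbb R^d)$ is the set of continuously differentiable functions whose derivative is Hölder continuous with exponent $\gamma$ on every compact subset of $\mathbb R^d$. -/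

import Mathlib

open MeasureTheory Set
open scoped FourierTransform NNReal ENNReal

namespace RelSchroedinger

/-- Euclidean space `ℝ^d`. -/
abbrev Space (d : ℕ) : Type := EuclideanSpace ℝ (Fin d)

/-- The complex Hilbert space `L²(ℝ^d)` (Lebesgue measure). -/
abbrev L2 (d : ℕ) : Type := Lp (α := Space d) ℂ 2

/-- `Φ_{m,α}(z) = (z + m^{2/α})^{α/2} - m`; for `m = 0`, `α > 0` this is `z^{α/2}`. -/
noncomputable def relPhi (m α z : ℝ) : ℝ := (z + m ^ (2 / α)) ^ (α / 2) - m

/-- The symbol `Φ_{m,α}(|y|²)` of the relativistic operator at the angular frequency `y = 2πξ`, since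
Mathlib's Fourier transform is `𝓕 f ξ = ∫ exp(-2πi⟨x,ξ⟩) f x dx`. -/
noncomputable def symbol (d : ℕ) (m α : ℝ) (ξ : Space d) : ℂ :=
  ((relPhi m α (‖(2 * Real.pi) • ξ‖ ^ 2) : ℝ) : ℂ)

/-- The product of the symbol with the `L²` Fourier transform of `f`. -/
noncomputable def symbolMul (d : ℕ) (m α : ℝ) (f : L2 d) (ξ : Space d) : ℂ :=
  symbol d m α ξ * (𝓕 f : L2 d) ξ

theorem symbolMul_add (d : ℕ) (m α : ℝ) (f g : L2 d) :
    symbolMul d m α (f + g) =ᵐ[volume] symbolMul d m α f + symbolMul d m α g := by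
  have h : (𝓕 (f + g) : L2 d) = 𝓕 f + 𝓕 g := FourierTransform.fourier_add f g
  filter_upwards [Lp.coeFn_add (𝓕 f : L2 d) (𝓕 g)] with ξ hξ
  simp only [symbolMul, Pi.add_apply, h, hξ]
  ring

theorem symbolMul_smul (d : ℕ) (m α : ℝ) (c : ℂ) (f : L2 d) :
    symbolMul d m α (c • f) =ᵐ[volume] c • symbolMul d m α f := by
  have h : (𝓕 (c • f) : L2 d) = c • 𝓕 f := FourierTransform.fourier_smul c f
  filter_upwards [Lp.coeFn_smul c (𝓕 f : L2 d)] with ξ hξ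
  simp only [symbolMul, Pi.smul_apply, h, hξ, smul_eq_mul]
  ring

theorem symbolMul_zero (d : ℕ) (m α : ℝ) :
    symbolMul d m α 0 =ᵐ[volume] 0 := by
  have h : symbolMul d m α 0 =ᵐ[volume] (0 : ℂ) • symbolMul d m α 0 := by
    simpa using symbolMul_smul d m α 0 0
  simpa using h

/-- The massive (`m > 0`) or massless (`m = 0`) relativistic operator
`L_{m,α} = (-Δ + m^{2/α})^{α/2} - m` on `L²(ℝ^d)`, an unbounded operator defined as a Fourier
multiplier on its maximal domain `{f ∈ L² : Φ_{m,α}(|·|²) f̂ ∈ L²}`. -/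
noncomputable def relOp (d : ℕ) (m α : ℝ) : L2 d →ₗ.[ℂ] L2 d where
  domain :=
    { carrier := {f | MemLp (symbolMul d m α f) 2 volume}
      add_mem' := fun {f g} hf hg =>
        (memLp_congr_ae (symbolMul_add d m α f g)).2 (MemLp.add hf hg)
      zero_mem' := (memLp_congr_ae (symbolMul_zero d m α)).2 MemLp.zero
      smul_mem' := fun c f hf =>
        (memLp_congr_ae (symbolMul_smul d m α c f)).2 (MemLp.const_smul hf c) }
  toFun :=
    { toFun := fun f => 𝓕⁻ (MemLp.toLp (symbolMul d m α f.1) f.2 : L2 d)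
      map_add' := by
        rintro ⟨f, hf⟩ ⟨g, hg⟩
        rw [← FourierTransform.fourierInv_add]
        congr 1
        rw [← MemLp.toLp_add]
        exact (MemLp.toLp_eq_toLp_iff _ _).2 (symbolMul_add d m α f g)
      map_smul' := by
        rintro c ⟨f, hf⟩
        simp only [RingHom.id_apply]
        rw [← FourierTransform.fourierInv_smul]
        congr 1
        rw [← MemLp.toLp_const_smul]
        exact (MemLp.toLp_eq_toLp_iff _ _).2 (symbolMul_smul d m α c f) }

/-- Multiplication by the indicator function of the ball `B_a` centred at the origin. -/
noncomputable def ballMul (d : ℕ) (a : ℝ) : L2 d →ₗ[ℂ] L2 d where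
  toFun f := MemLp.toLp ((Metric.ball (0 : Space d) a).indicator f)
    ((Lp.memLp f).indicator measurableSet_ball)
  map_add' f g := by
    rw [← MemLp.toLp_add]
    refine (MemLp.toLp_eq_toLp_iff _ _).2 ?_
    filter_upwards [Lp.coeFn_add f g] with x hx
    by_cases h : x ∈ Metric.ball (0 : Space d) a
    · simp only [Pi.add_apply, indicator_of_mem h]
      exact hx
    · simp [indicator_of_notMem h]
  map_smul' c f := by
    simp only [RingHom.id_apply]
    rw [← MemLp.toLp_const_smul]
    refine (MemLp.toLp_eq_toLp_iff _ _).2 ?_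
    filter_upwards [Lp.coeFn_smul c f] with x hx
    by_cases h : x ∈ Metric.ball (0 : Space d) a
    · simp only [Pi.smul_apply, indicator_of_mem h]
      exact hx
    · simp [indicator_of_notMem h]

/-- The relativistic Schrödinger operator `H_{m,α} = L_{m,α} - v 1_{B_a}`, with the domain of
`L_{m,α}` (the potential is bounded). -/
noncomputable def schroedingerOp (d : ℕ) (m α v a : ℝ) : L2 d →ₗ.[ℂ] L2 d where
  domain := (relOp d m α).domain
  toFun := (relOp d m α).toFun - (v : ℂ) • (ballMul d a).comp (relOp d m α).domain.subtype

/-- The resolvent set of an unbounded operator `A`: the `z` for which `A - z : Dom A → F` has a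
bounded everywhere defined two-sided inverse `R`. -/
def resolventSetOf {F : Type*} [NormedAddCommGroup F] [NormedSpace ℂ F] (A : F →ₗ.[ℂ] F) : Set ℂ :=
  {z | ∃ R : F →L[ℂ] F,
    (∀ y : F, ∃ x : A.domain, (x : F) = R y ∧ A x - z • (x : F) = y) ∧
    ∀ x : A.domain, R (A x - z • (x : F)) = x}

/-- The spectrum of an unbounded operator: the complement of its resolvent set. -/
def spec {F : Type*} [NormedAddCommGroup F] [NormedSpace ℂ F] (A : F →ₗ.[ℂ] F) : Set ℂ :=
  (resolventSetOf A)ᶜ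

/-- The function `φ` is (a version of) a ground state of `H_{m,α} = L_{m,α} - v 1_{B_a}`: its class
in `L²(ℝ^d)` is a non-zero element of the domain and an eigenvector of `H_{m,α}` for the eigenvalue
`λ₀ = inf Spec H_{m,α}`. -/
def IsGroundState (d : ℕ) (m α v a : ℝ) (φ : Space d → ℂ) : Prop :=
  ∃ (lam₀ : ℝ) (ψ : (schroedingerOp d m α v a).domain),
    IsGLB {t : ℝ | (t : ℂ) ∈ spec (schroedingerOp d m α v a)} lam₀ ∧
    (ψ : L2 d) ≠ 0 ∧
    schroedingerOp d m α v a ψ = (lam₀ : ℂ) • (ψ : L2 d) ∧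
    φ =ᵐ[volume] (ψ : L2 d)

/-- `f` is locally Hölder continuous with exponent `γ`: for `0 < γ < 1` and `Y` a Euclidean space this
is the class `C^γ_loc(ℝ^d)`. -/
def LocHolder {d : ℕ} {Y : Type*} [NormedAddCommGroup Y] (γ : ℝ≥0) (f : Space d → Y) : Prop :=
  ∀ K : Set (Space d), IsCompact K → ∃ C : ℝ≥0, HolderOnWith C γ f K

/-- The class `C^{1,γ}_loc(ℝ^d)`: continuously differentiable functions whose derivative is locally
Hölder continuous with exponent `γ`. -/
def LocC1Holder {d : ℕ} (γ : ℝ≥0) (f : Space d → ℂ) : Prop :=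
  ContDiff ℝ 1 f ∧ LocHolder γ (fderiv ℝ f)

end RelSchroedinger

/-!
Suppose that a ground state `φ` had more than `α` derivatives in the Hölder sense. Then `L_{m,α} φ`
would be continuous, whereas it equals `(λ₀ + v 1_{B_a}) φ`, which jumps by `v φ` across the sphere
`|x| = a`. Hence `φ` and `L_{m,α} φ` would both vanish on that sphere. But `φ` is a constant multiple
of a non-negative non-zero function, and where such a function vanishes, the nonlocal operator
`L_{m,α}` does not: a contradiction.

Everything is reduced to the heat semigroup through the Lévy–Khinchine (subordination) formula
`Φ_{m,α}(z) = ∫₀^∞ (1 - exp (-t z)) k(t) dt` with an explicit density `k > 0`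
(`relPhi_eq_integral`), that is, `L_{m,α} = ∫₀^∞ (1 - exp (tΔ)) k(t) dt`.

* Regularity. Hölder regularity enters only through symmetric second differences
  (`LocSecondDiff`). They make `φ - exp (tΔ) φ` of order `t ^ (γ / 2)` with `γ > α`, locally
  uniformly (`exists_norm_sub_heat_le`). So the pointwise integral `levyOp` converges and is
  continuous (`continuous_levyOp`), and by Plancherel and Fubini it agrees almost everywhere with
  the Fourier multiplier (`levyOp_ae_eq_relOp`).
* Constant phase. Since `λ₀` is the infimum of the spectrum, the form of `H_{m,α}` is bounded below
  by `λ₀` (`le_re_inner_of_mem_resolventSetOf`, `form_lower_bound`). The heat kernel is positive, so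
  passing from `φ` to `|φ|` does not increase the form of `1 - exp (tΔ)` for any `t`
  (`heatForm_absL2_le`), and minimality forces equality for almost every `t`; for a continuous
  `φ` this yields a constant phase (`exists_phase_of_apply_eq_smul`).
* Contradiction at the sphere: `eq_zero_of_mem_sphere` and `levyOp_ne_zero`.
-/

namespace RelSchroedinger

variable {d : ℕ}

/-! ### Fourier transform and heat semigroup on `L²` -/

open SchwartzMap in
/-- On `L¹ ∩ L²` the inverse Fourier transform of `L²` is the inverse Fourier integral: both define the
same tempered distribution. -/
theorem fourierInv_toLp_ae_eq {h : Space d → ℂ} (h1 : Integrable h)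
    (h2 : MemLp h 2 volume) : (𝓕⁻ (h2.toLp h) : L2 d) =ᵐ[volume] 𝓕⁻ h := by
  have hc : Continuous (𝓕⁻ h) := by
    rw [Real.fourierInv_eq_fourier_comp_neg]
    exact VectorFourier.fourierIntegral_continuous Real.continuous_fourierChar
      (L := innerₗ (Space d)) continuous_inner h1.comp_neg
  refine ae_eq_of_integral_contDiff_smul_eq ((Lp.memLp _).locallyIntegrable (by norm_num))
    hc.locallyIntegrable ?_
  intro g g_smooth g_cpt
  have hg₁ : HasCompactSupport (Complex.ofRealCLM ∘ g) := g_cpt.comp_left rfl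
  have hg₂ : ContDiff ℝ ((⊤ : ℕ∞) : WithTop ℕ∞) (Complex.ofRealCLM ∘ g) :=
    Complex.ofRealCLM.contDiff.comp g_smooth
  set G : 𝓢(Space d, ℂ) := hg₁.toSchwartzMap hg₂ with hG
  have e1 : ∫ x, g x • (𝓕⁻ (h2.toLp h) : L2 d) x
      = ((𝓕⁻ (h2.toLp h) : L2 d) : 𝓢'(Space d, ℂ)) G := by
    simp [G]
  have e2 : ((𝓕⁻ (h2.toLp h) : L2 d) : 𝓢'(Space d, ℂ)) G = ∫ x, (𝓕⁻ G) x * h x := by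
    rw [← Lp.fourierInv_toTemperedDistribution_eq, TemperedDistribution.fourierInv_apply,
      Lp.toTemperedDistribution_apply]
    refine integral_congr_ae ?_
    filter_upwards [h2.coeFn_toLp] with x hx
    rw [hx, smul_eq_mul]
  have e3 : ∫ x, (𝓕⁻ G) x * h x = ∫ x, G x * 𝓕⁻ h x := by
    rw [SchwartzMap.fourierInv_coe]
    have := VectorFourier.integral_fourierIntegral_smul_eq_flip (μ := volume) (ν := volume)
      (L := -innerₗ (Space d)) Real.continuous_fourierChar (by
        simp only [LinearMap.neg_apply, innerₗ_apply_apply]; fun_prop) G.integrable h1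
    simp only [smul_eq_mul] at this
    convert! this using 3 with x
    congr 1
    simp [Real.fourierInv_eq, VectorFourier.fourierIntegral, real_inner_comm]
  rw [e1, e2, e3]
  simp [G]

/-- The squared angular frequency `|2πξ|²`. -/
noncomputable def freqSq (ξ : Space d) : ℝ := ‖(2 * Real.pi) • ξ‖ ^ 2

theorem freqSq_eq (ξ : Space d) : freqSq ξ = 4 * Real.pi ^ 2 * ‖ξ‖ ^ 2 := by
  rw [freqSq, norm_smul, Real.norm_of_nonneg (by positivity)]; ring

theorem freqSq_nonneg (ξ : Space d) : 0 ≤ freqSq ξ := sq_nonneg _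

@[fun_prop]
theorem continuous_freqSq : Continuous (freqSq (d := d)) := by
  unfold freqSq; fun_prop

/-- The heat kernel of `ℝ^d` at time `t`, normalised so that its Fourier transform is
`ξ ↦ exp (-t |2πξ|²)`. -/
noncomputable def heatKernel (t : ℝ) (x : Space d) : ℝ :=
  (4 * Real.pi * t)⁻¹ ^ ((d : ℝ) / 2) * Real.exp (-(‖x‖ ^ 2 / (4 * t)))

/-- The heat semigroup `exp (tΔ)`, as a convolution. -/
noncomputable def heat (t : ℝ) (f : Space d → ℂ) (x : Space d) : ℂ :=
  ∫ y, (heatKernel t (x - y) : ℂ) * f y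

/-- The Fourier multiplier `exp (-t |2πξ|²)` of the heat semigroup. -/
noncomputable def heatSymbol (t : ℝ) (ξ : Space d) : ℝ := Real.exp (-(t * freqSq ξ))

theorem heatKernel_pos {t : ℝ} (ht : 0 < t) (x : Space d) : 0 < heatKernel t x := by
  unfold heatKernel; positivity

theorem heatKernel_neg (t : ℝ) (x : Space d) : heatKernel t (-x) = heatKernel t x := by
  simp [heatKernel]

@[fun_prop]
theorem continuous_heatKernel (t : ℝ) : Continuous (heatKernel (d := d) t) := by
  unfold heatKernel; fun_prop

@[fun_prop]
theorem continuous_heatSymbol (t : ℝ) : Continuous (heatSymbol (d := d) t) := by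
  unfold heatSymbol; fun_prop

theorem heatSymbol_pos (t : ℝ) (ξ : Space d) : 0 < heatSymbol t ξ := Real.exp_pos _

theorem heatSymbol_le_one {t : ℝ} (ht : 0 ≤ t) (ξ : Space d) : heatSymbol t ξ ≤ 1 := by
  unfold heatSymbol
  rw [Real.exp_le_one_iff]
  have := mul_nonneg ht (freqSq_nonneg ξ)
  linarith

theorem integrable_exp_neg_mul_sq_norm {b : ℝ} (hb : 0 < b) :
    Integrable (fun x : Space d => Real.exp (-(b * ‖x‖ ^ 2))) := by
  have := (GaussianFourier.integrable_cexp_neg_mul_sq_norm_add (V := Space d) (b := (b : ℂ))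
    (by simpa using hb) 0 0).norm
  refine this.congr (Filter.Eventually.of_forall fun x => ?_)
  simp only [Complex.norm_exp]
  congr 1
  norm_cast
  simp

theorem integrable_heatKernel {t : ℝ} (ht : 0 < t) :
    Integrable (heatKernel (d := d) t) := by
  unfold heatKernel
  refine Integrable.const_mul ?_ _
  convert! integrable_exp_neg_mul_sq_norm (d := d) (b := 1 / (4 * t)) (by positivity) using 4
  ring

theorem integral_heatKernel {t : ℝ} (ht : 0 < t) :
    ∫ x : Space d, heatKernel t x = 1 := by
  unfold heatKernel
  rw [integral_const_mul]
  have := GaussianFourier.integral_rexp_neg_mul_sq_norm (V := Space d) (b := 1 / (4 * t))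
    (by positivity)
  have h2 : ∀ x : Space d, -(‖x‖ ^ 2 / (4 * t)) = -(1 / (4 * t)) * ‖x‖ ^ 2 := fun x => by ring
  simp_rw [h2]
  rw [this, finrank_euclideanSpace_fin, ← Real.mul_rpow (by positivity) (by positivity)]
  have : (4 * Real.pi * t)⁻¹ * (Real.pi / (1 / (4 * t))) = 1 := by field_simp
  rw [this, Real.one_rpow]

theorem heatKernel_le {t : ℝ} (ht : 0 < t) (x : Space d) :
    heatKernel t x ≤ (4 * Real.pi * t)⁻¹ ^ ((d : ℝ) / 2) := by
  unfold heatKernel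
  refine mul_le_of_le_one_right (by positivity) ?_
  rw [Real.exp_le_one_iff, neg_nonpos]
  positivity

theorem memLp_heatKernel_sub {t : ℝ} (ht : 0 < t) (x : Space d) :
    MemLp (fun y => (heatKernel t (x - y) : ℂ)) 2 volume := by
  have h1 : Integrable (fun y => (heatKernel t (x - y) : ℂ)) :=
    ((integrable_heatKernel ht).comp_sub_left x).ofReal
  have hb : ∀ y, ‖(heatKernel t (x - y) : ℂ)‖ ≤ (4 * Real.pi * t)⁻¹ ^ ((d : ℝ) / 2) := fun y => by
    rw [Complex.norm_real, Real.norm_of_nonneg (heatKernel_pos ht _).le]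
    exact heatKernel_le ht _
  rw [memLp_two_iff_integrable_sq_norm h1.1]
  refine (h1.norm.const_mul ((4 * Real.pi * t)⁻¹ ^ ((d : ℝ) / 2))).mono' (h1.1.norm.pow 2) ?_
  refine Filter.Eventually.of_forall fun y => ?_
  rw [Real.norm_of_nonneg (by positivity), sq]
  exact mul_le_mul_of_nonneg_right (hb y) (norm_nonneg _)

theorem integrable_heatSymbol {t : ℝ} (ht : 0 < t) :
    Integrable (heatSymbol (d := d) t) := by
  unfold heatSymbol
  convert! integrable_exp_neg_mul_sq_norm (d := d) (b := t * (4 * Real.pi ^ 2)) (by positivity)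
    using 4 with x
  rw [freqSq_eq]; ring

/-- The plane wave `ξ ↦ exp (-2πi⟨x,ξ⟩) exp (-t |2πξ|²)`, whose inverse Fourier transform is
the heat kernel centred at `x`. -/
noncomputable def heatWave (t : ℝ) (x ξ : Space d) : ℂ :=
  Complex.exp (-((4 * Real.pi ^ 2 * t : ℝ) : ℂ) * ‖ξ‖ ^ 2
    + 2 * Real.pi * Complex.I * (inner ℝ (-x) ξ : ℝ))

theorem norm_heatWave (t : ℝ) (x ξ : Space d) : ‖heatWave t x ξ‖ = heatSymbol t ξ := by
  rw [heatWave, Complex.norm_exp, heatSymbol, freqSq_eq]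
  congr 1
  simp [← Complex.ofReal_pow]
  ring

@[fun_prop]
theorem continuous_heatWave (t : ℝ) (x : Space d) : Continuous (heatWave t x) := by
  unfold heatWave; fun_prop

theorem integrable_heatWave {t : ℝ} (ht : 0 < t) (x : Space d) :
    Integrable (heatWave t x) := by
  rw [← integrable_norm_iff (continuous_heatWave t x).aestronglyMeasurable]
  simp_rw [norm_heatWave]
  exact integrable_heatSymbol ht

theorem memLp_heatWave {t : ℝ} (ht : 0 < t) (x : Space d) :
    MemLp (heatWave t x) 2 volume := by
  rw [memLp_two_iff_integrable_sq_norm (continuous_heatWave t x).aestronglyMeasurable]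
  refine (integrable_heatSymbol ht).mono' (by fun_prop) ?_
  refine Filter.Eventually.of_forall fun ξ => ?_
  rw [norm_heatWave, Real.norm_of_nonneg (by positivity), sq]
  exact mul_le_of_le_one_right (heatSymbol_pos t ξ).le (heatSymbol_le_one ht.le ξ)

theorem fourierInv_heatWave {t : ℝ} (ht : 0 < t) (x y : Space d) :
    𝓕⁻ (heatWave t x) y = heatKernel t (x - y) := by
  rw [Real.fourierInv_eq_fourier_neg]
  unfold heatWave
  have := fourier_gaussian_innerProductSpace' (V := Space d)
    (b := ((4 * Real.pi ^ 2 * t : ℝ) : ℂ)) (by rw [Complex.ofReal_re]; positivity) (-x) (-y)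
  rw [this, finrank_euclideanSpace_fin, heatKernel]
  push_cast
  have hpi : (Real.pi : ℂ) ≠ 0 := by exact_mod_cast Real.pi_ne_zero
  have htc : (t : ℂ) ≠ 0 := by exact_mod_cast ht.ne'
  congr 1
  · have : (Real.pi : ℂ) / (4 * Real.pi ^ 2 * t) = (((4 * Real.pi * t)⁻¹ : ℝ) : ℂ) := by
      push_cast; field_simp
    rw [this, Complex.ofReal_cpow (by positivity)]
    push_cast; rfl
  · congr 1
    rw [show -x - -y = -(x - y) by abel, norm_neg]
    field_simp

/-- Plancherel's identity, applied to the heat kernel centred at `x`, expresses `exp (tΔ) f (x)`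
through the `L²` Fourier transform of `f`. -/
theorem heat_eq_integral_fourier {t : ℝ} (ht : 0 < t) (f : L2 d) (x : Space d) :
    heat t f x = ∫ ξ, (starRingEnd ℂ (heatWave t x ξ)) * (𝓕 f : L2 d) ξ := by
  have h := Lp.inner_fourier_eq (𝓕⁻ ((memLp_heatWave ht x).toLp _) : L2 d) f
  rw [FourierTransform.fourier_fourierInv_eq, L2.inner_def, L2.inner_def] at h
  have e1 : ∫ ξ, (starRingEnd ℂ (heatWave t x ξ)) * (𝓕 f : L2 d) ξ
      = ∫ ξ, inner ℂ (((memLp_heatWave ht x).toLp _ : L2 d) ξ) ((𝓕 f : L2 d) ξ) := by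
    refine integral_congr_ae ?_
    filter_upwards [(memLp_heatWave ht x).coeFn_toLp] with ξ hξ
    rw [hξ, RCLike.inner_apply, mul_comm]
  rw [e1, h]
  refine integral_congr_ae ?_
  filter_upwards [fourierInv_toLp_ae_eq (integrable_heatWave ht x) (memLp_heatWave ht x)] with y hy
  rw [hy, fourierInv_heatWave ht, RCLike.inner_apply, Complex.conj_ofReal, mul_comm]

theorem memLp_heatSymbol_mul {t : ℝ} (ht : 0 ≤ t) (f : L2 d) :
    MemLp (fun ξ => (heatSymbol t ξ : ℂ) * (𝓕 f : L2 d) ξ) 2 volume := by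
  refine (Lp.memLp (𝓕 f : L2 d)).mono ?_ (Filter.Eventually.of_forall fun ξ => ?_)
  · exact (by fun_prop : Continuous fun ξ : Space d => (heatSymbol t ξ : ℂ)).aestronglyMeasurable.mul
      (Lp.aestronglyMeasurable _)
  · rw [norm_mul, Complex.norm_real, Real.norm_of_nonneg (heatSymbol_pos t ξ).le]
    exact mul_le_of_le_one_left (norm_nonneg _) (heatSymbol_le_one ht ξ)

theorem integrable_heatSymbol_mul {t : ℝ} (ht : 0 < t) (f : L2 d) :
    Integrable (fun ξ => (heatSymbol t ξ : ℂ) * (𝓕 f : L2 d) ξ) := by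
  have := (memLp_heatWave ht (0 : Space d)).integrable_mul (Lp.memLp (𝓕 f : L2 d))
  refine this.congr (Filter.Eventually.of_forall fun ξ => ?_)
  simp [heatWave, heatSymbol, freqSq_eq]
  left; congr 1; ring

theorem heat_eq_fourierInv {t : ℝ} (ht : 0 < t) (f : L2 d) :
    heat t f = 𝓕⁻ (fun ξ => (heatSymbol t ξ : ℂ) * (𝓕 f : L2 d) ξ) := by
  ext x
  rw [heat_eq_integral_fourier ht, Real.fourierInv_eq']
  congr 1; ext ξ
  rw [smul_eq_mul, ← mul_assoc]
  congr 1
  rw [heatWave, heatSymbol, freqSq_eq, ← Complex.exp_conj, Complex.ofReal_exp, ← Complex.exp_add]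
  congr 1
  simp [real_inner_comm, map_ofNat]
  ring

theorem continuous_heat {t : ℝ} (ht : 0 < t) (f : L2 d) : Continuous (heat t f) := by
  rw [heat_eq_fourierInv ht, Real.fourierInv_eq_fourier_comp_neg]
  exact VectorFourier.fourierIntegral_continuous Real.continuous_fourierChar
      (L := innerₗ (Space d)) continuous_inner (integrable_heatSymbol_mul ht f).comp_neg

theorem heat_ae_eq {t : ℝ} (ht : 0 < t) (f : L2 d) :
    heat t f =ᵐ[volume] (𝓕⁻ ((memLp_heatSymbol_mul ht.le f).toLp _) : L2 d) := by
  rw [heat_eq_fourierInv ht]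
  exact (fourierInv_toLp_ae_eq (integrable_heatSymbol_mul ht f) _).symm

theorem memLp_heat {t : ℝ} (ht : 0 < t) (f : L2 d) : MemLp (heat t f) 2 volume :=
  (memLp_congr_ae (heat_ae_eq ht f)).2 (Lp.memLp _)

/-- Plancherel's identity for `⟨g, exp (tΔ) f⟩`. -/
theorem integral_conj_mul_heat {t : ℝ} (ht : 0 < t) (g f : L2 d) :
    ∫ x, (starRingEnd ℂ (g x)) * heat t f x
      = ∫ ξ, (starRingEnd ℂ ((𝓕 g : L2 d) ξ)) * ((heatSymbol t ξ : ℂ) * (𝓕 f : L2 d) ξ) := by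
  have h := Lp.inner_fourier_eq g (𝓕⁻ ((memLp_heatSymbol_mul ht.le f).toLp _) : L2 d)
  rw [FourierTransform.fourier_fourierInv_eq, L2.inner_def, L2.inner_def] at h
  have e1 : ∫ x, (starRingEnd ℂ (g x)) * heat t f x
      = ∫ x, inner ℂ (g x) ((𝓕⁻ ((memLp_heatSymbol_mul ht.le f).toLp _) : L2 d) x) := by
    refine integral_congr_ae ?_
    filter_upwards [heat_ae_eq ht f] with ξ hξ
    rw [hξ, RCLike.inner_apply, mul_comm]
  rw [e1, ← h]
  refine integral_congr_ae ?_
  filter_upwards [(memLp_heatSymbol_mul ht.le f).coeFn_toLp] with ξ hξ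
  rw [hξ, RCLike.inner_apply, mul_comm]

/-! ### Subordination formula for the symbol -/

theorem integrableOn_min_rpow_mul_rpow {p β : ℝ} (hβ : 0 < β) (hp : β < p) :
    IntegrableOn (fun t : ℝ => min (t ^ p) 1 * t ^ (-1 - β)) (Ioi 0) := by
  have hmeas : Measurable fun t : ℝ => min (t ^ p) 1 * t ^ (-1 - β) := by fun_prop
  rw [← Ioc_union_Ioi_eq_Ioi (zero_le_one (α := ℝ)), integrableOn_union]
  constructor
  · have h : IntegrableOn (fun t : ℝ => t ^ (p - 1 - β)) (Ioc 0 1) := by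
      rw [← intervalIntegrable_iff_integrableOn_Ioc_of_le zero_le_one]
      exact intervalIntegral.intervalIntegrable_rpow' (by linarith)
    refine h.mono' hmeas.aestronglyMeasurable ?_
    refine (ae_restrict_iff' measurableSet_Ioc).2 (Filter.Eventually.of_forall fun t ht => ?_)
    have ht0 : 0 < t := ht.1
    rw [Real.norm_of_nonneg (by positivity)]
    calc min (t ^ p) 1 * t ^ (-1 - β) ≤ t ^ p * t ^ (-1 - β) := by gcongr; exact min_le_left _ _
      _ = t ^ (p - 1 - β) := by rw [← Real.rpow_add ht0]; ring_nf
  · have h : IntegrableOn (fun t : ℝ => t ^ (-1 - β)) (Ioi 1) :=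
      integrableOn_Ioi_rpow_of_lt (by linarith) zero_lt_one
    refine h.mono' hmeas.aestronglyMeasurable ?_
    refine (ae_restrict_iff' measurableSet_Ioi).2 (Filter.Eventually.of_forall fun t ht => ?_)
    have ht0 : 0 < t := zero_lt_one.trans ht
    rw [Real.norm_of_nonneg (by positivity)]
    exact mul_le_of_le_one_left (by positivity) (min_le_right _ _)

theorem one_sub_exp_neg_le {z t : ℝ} (ht : 0 ≤ t) :
    1 - Real.exp (-(t * z)) ≤ max z 1 * min t 1 := by
  rcases le_total t 1 with h | h
  · rw [min_eq_left h]
    have := Real.add_one_le_exp (-(t * z))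
    have h2 : z * t ≤ max z 1 * t := by gcongr; exact le_max_left _ _
    linarith
  · rw [min_eq_right h]
    have := Real.exp_pos (-(t * z))
    have := le_max_right z 1
    linarith

theorem one_sub_exp_neg_nonneg {z t : ℝ} (hz : 0 ≤ z) (ht : 0 ≤ t) :
    0 ≤ 1 - Real.exp (-(t * z)) := by
  rw [sub_nonneg, Real.exp_le_one_iff, neg_nonpos]
  positivity

theorem integrableOn_one_sub_exp_mul_rpow {β z : ℝ} (hβ : 0 < β) (hβ1 : β < 1) (hz : 0 ≤ z) :
    IntegrableOn (fun t : ℝ => (1 - Real.exp (-(t * z))) * t ^ (-1 - β)) (Ioi 0) := by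
  refine ((integrableOn_min_rpow_mul_rpow hβ hβ1).const_mul (max z 1)).mono'
    (by fun_prop : Measurable _).aestronglyMeasurable ?_
  refine (ae_restrict_iff' measurableSet_Ioi).2 (Filter.Eventually.of_forall fun t ht => ?_)
  have ht0 : 0 < t := ht
  have h1 := one_sub_exp_neg_nonneg hz ht0.le
  rw [Real.norm_of_nonneg (by positivity), Real.rpow_one, ← mul_assoc]
  gcongr
  exact one_sub_exp_neg_le ht0.le

/-- The constant `∫₀^∞ (1 - exp (-t)) t^(-1-β) dt`. -/
noncomputable def levyIntegral (β : ℝ) : ℝ :=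
  ∫ t in Ioi (0 : ℝ), (1 - Real.exp (-(t * 1))) * t ^ (-1 - β)

theorem levyIntegral_pos {β : ℝ} (hβ : 0 < β) (hβ1 : β < 1) : 0 < levyIntegral β := by
  unfold levyIntegral
  refine (setIntegral_pos_iff_support_of_nonneg_ae ?_
    (integrableOn_one_sub_exp_mul_rpow hβ hβ1 zero_le_one)).2 ?_
  · refine (ae_restrict_iff' measurableSet_Ioi).2 (Filter.Eventually.of_forall fun t ht => ?_)
    have ht0 : 0 < t := ht
    exact mul_nonneg (one_sub_exp_neg_nonneg zero_le_one ht0.le) (by positivity)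
  · have : Ioi (0 : ℝ) ⊆ Function.support
        (fun t : ℝ => (1 - Real.exp (-(t * 1))) * t ^ (-1 - β)) := fun t ht => by
      have ht0 : 0 < t := ht
      have : Real.exp (-(t * 1)) < 1 := by rw [Real.exp_lt_one_iff]; linarith
      exact (mul_pos (sub_pos.2 this) (by positivity)).ne'
    rw [inter_eq_right.2 this]
    simp

theorem integral_one_sub_exp_mul_rpow {β z : ℝ} (hβ : 0 < β) (hz : 0 ≤ z) :
    ∫ t in Ioi (0 : ℝ), (1 - Real.exp (-(t * z))) * t ^ (-1 - β) = z ^ β * levyIntegral β := by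
  rcases hz.eq_or_lt with rfl | hz
  · simp [Real.zero_rpow hβ.ne']
  have h := integral_comp_mul_left_Ioi
    (fun s : ℝ => (1 - Real.exp (-(s * 1))) * s ^ (-1 - β)) 0 hz
  rw [mul_zero] at h
  have e : ∫ t in Ioi (0 : ℝ), (1 - Real.exp (-(z * t * 1))) * (z * t) ^ (-1 - β)
      = z ^ (-1 - β) * ∫ t in Ioi (0 : ℝ), (1 - Real.exp (-(t * z))) * t ^ (-1 - β) := by
    rw [← integral_const_mul]
    refine setIntegral_congr_fun measurableSet_Ioi fun t ht => ?_
    have ht0 : 0 < t := ht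
    rw [Real.mul_rpow hz.le ht0.le]
    ring_nf
  rw [e, smul_eq_mul] at h
  have h3 : z ^ β * z * z ^ (-1 - β) = 1 := by
    rw [← Real.rpow_add_one hz.ne', ← Real.rpow_add hz]; ring_nf; exact Real.rpow_zero z
  unfold levyIntegral
  calc _ = (z ^ β * z * z ^ (-1 - β)) *
        ∫ t in Ioi (0 : ℝ), (1 - Real.exp (-(t * z))) * t ^ (-1 - β) := by rw [h3, one_mul]
    _ = z ^ β * (z * z⁻¹) * ∫ t in Ioi (0 : ℝ), (1 - Real.exp (-(t * 1))) * t ^ (-1 - β) := by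
        rw [mul_assoc (z ^ β * z), h]; ring
    _ = _ := by rw [mul_inv_cancel₀ hz.ne', mul_one]

/-- The density of the Lévy measure of the Bernstein function `Φ_{m,α}`. -/
noncomputable def levyWeight (m α t : ℝ) : ℝ :=
  (levyIntegral (α / 2))⁻¹ * (Real.exp (-(t * m ^ (2 / α))) * t ^ (-1 - α / 2))

section levyWeight

variable {m α : ℝ}

@[fun_prop]
theorem measurable_levyWeight : Measurable (levyWeight m α) := by
  unfold levyWeight; fun_prop

theorem levyWeight_pos (hα0 : 0 < α) (hα2 : α < 2) {t : ℝ} (ht : 0 < t) :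
    0 < levyWeight m α t := by
  have := levyIntegral_pos (β := α / 2) (by linarith) (by linarith)
  unfold levyWeight; positivity

theorem levyWeight_le (hm : 0 ≤ m) (hα0 : 0 < α) (hα2 : α < 2) {t : ℝ} (ht : 0 < t) :
    levyWeight m α t ≤ (levyIntegral (α / 2))⁻¹ * t ^ (-1 - α / 2) := by
  have := levyIntegral_pos (β := α / 2) (by linarith) (by linarith)
  unfold levyWeight
  gcongr
  refine mul_le_of_le_one_left (by positivity) ?_
  rw [Real.exp_le_one_iff, neg_nonpos]
  positivity

theorem integrableOn_min_rpow_mul_levyWeight (hm : 0 ≤ m) (hα0 : 0 < α) (hα2 : α < 2) {p : ℝ}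
    (hp : α / 2 < p) : IntegrableOn (fun t => min (t ^ p) 1 * levyWeight m α t) (Ioi 0) := by
  refine ((integrableOn_min_rpow_mul_rpow (by linarith) hp).const_mul
    (levyIntegral (α / 2))⁻¹).mono' (by fun_prop : Measurable _).aestronglyMeasurable ?_
  refine (ae_restrict_iff' measurableSet_Ioi).2 (Filter.Eventually.of_forall fun t ht => ?_)
  have ht0 : 0 < t := ht
  have h2 := levyWeight_pos (m := m) hα0 hα2 ht0
  rw [Real.norm_of_nonneg (by positivity), mul_left_comm]
  gcongr
  exact levyWeight_le hm hα0 hα2 ht0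

theorem integrableOn_one_sub_exp_mul_levyWeight (hm : 0 ≤ m) (hα0 : 0 < α) (hα2 : α < 2) {z : ℝ}
    (hz : 0 ≤ z) :
    IntegrableOn (fun t => (1 - Real.exp (-(t * z))) * levyWeight m α t) (Ioi 0) := by
  refine ((integrableOn_min_rpow_mul_levyWeight hm hα0 hα2 (p := 1) (by linarith)).const_mul
    (max z 1)).mono' (by fun_prop : Measurable _).aestronglyMeasurable ?_
  refine (ae_restrict_iff' measurableSet_Ioi).2 (Filter.Eventually.of_forall fun t ht => ?_)
  have ht0 : 0 < t := ht
  have h1 := one_sub_exp_neg_nonneg hz ht0.le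
  have h2 := levyWeight_pos (m := m) hα0 hα2 ht0
  rw [Real.norm_of_nonneg (by positivity), Real.rpow_one, ← mul_assoc]
  gcongr
  exact one_sub_exp_neg_le ht0.le

/-- The Lévy–Khinchine formula for `Φ_{m,α}`, obtained from the one for `z ↦ z ^ (α / 2)` by
subtracting its values at `z + m ^ (2 / α)` and at `m ^ (2 / α)`. -/
theorem relPhi_eq_integral (hm : 0 ≤ m) (hα0 : 0 < α) (hα2 : α < 2) {z : ℝ} (hz : 0 ≤ z) :
    relPhi m α z = ∫ t in Ioi (0 : ℝ), (1 - Real.exp (-(t * z))) * levyWeight m α t := by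
  have hI := levyIntegral_pos (β := α / 2) (by linarith) (by linarith)
  set M := m ^ (2 / α) with hM
  have hM0 : 0 ≤ M := by positivity
  have hMm : M ^ (α / 2) = m := by
    rw [hM, ← Real.rpow_mul hm, div_mul_div_cancel₀ hα0.ne', div_self two_ne_zero, Real.rpow_one]
  have e1 := integral_one_sub_exp_mul_rpow (β := α / 2) (by linarith) (add_nonneg hz hM0)
  have e2 := integral_one_sub_exp_mul_rpow (β := α / 2) (by linarith) hM0
  have i1 := integrableOn_one_sub_exp_mul_rpow (β := α / 2) (by linarith) (by linarith)
    (add_nonneg hz hM0)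
  have i2 := integrableOn_one_sub_exp_mul_rpow (β := α / 2) (by linarith) (by linarith) hM0
  have e3 : ∫ t in Ioi (0 : ℝ), (1 - Real.exp (-(t * z))) * levyWeight m α t
      = (levyIntegral (α / 2))⁻¹ * ((∫ t in Ioi (0 : ℝ),
          (1 - Real.exp (-(t * (z + M)))) * t ^ (-1 - α / 2))
        - ∫ t in Ioi (0 : ℝ), (1 - Real.exp (-(t * M))) * t ^ (-1 - α / 2)) := by
    rw [← integral_sub i1 i2, ← integral_const_mul]
    refine integral_congr_ae (Filter.Eventually.of_forall fun t => ?_)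
    simp only [levyWeight, mul_add, neg_add, Real.exp_add]
    ring
  rw [e3, e1, e2, hMm, relPhi, ← hM]
  field_simp

end levyWeight

/-! ### Variational lower bound from the spectrum -/

/-- A symmetric operator that is bounded below is bounded below by every `lam` such that all real
numbers below `lam` lie in the resolvent set. At the optimal lower bound `l` a bounded inverse `R`
of `A - l` improves the bound to `l + 1 / ‖R‖`, by the Cauchy–Schwarz inequality for the
non-negative form of `A - l`. -/
theorem le_re_inner_of_mem_resolventSetOf {F : Type*} [NormedAddCommGroup F]
    [InnerProductSpace ℂ F] (A : F →ₗ.[ℂ] F)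
    (hsymm : ∀ x y : A.domain, inner ℂ (A x) (y : F) = inner ℂ (x : F) (A y))
    {c lam : ℝ} (hc : ∀ x : A.domain, c * ‖(x : F)‖ ^ 2 ≤ (inner ℂ (x : F) (A x)).re)
    (hres : ∀ t : ℝ, t < lam → (t : ℂ) ∈ resolventSetOf A) (x : A.domain) :
    lam * ‖(x : F)‖ ^ 2 ≤ (inner ℂ (x : F) (A x)).re := by
  by_contra! hx₀
  set S : Set ℝ := {c | ∀ x : A.domain, c * ‖(x : F)‖ ^ 2 ≤ (inner ℂ (x : F) (A x)).re} with hS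
  have hne : (x : F) ≠ 0 := by
    intro h
    have : x = 0 := by ext; exact h
    simp [this] at hx₀
  have hn : 0 < ‖(x : F)‖ ^ 2 := by positivity
  set b := (inner ℂ (x : F) (A x)).re / ‖(x : F)‖ ^ 2 with hb
  have hSb : b ∈ upperBounds S := fun s hs => by
    rw [hb, le_div_iff₀ hn]; exact hs x
  have hbl : b < lam := by rwa [hb, div_lt_iff₀ hn]
  have hSne : S.Nonempty := ⟨c, hc⟩
  set l := sSup S with hl
  have hllam : l < lam := (csSup_le hSne hSb).trans_lt hbl
  have hlS : l ∈ S := by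
    intro y
    rcases eq_or_ne (‖(y : F)‖ ^ 2) 0 with h0 | h0
    · have := hc y
      rw [h0, mul_zero] at this ⊢
      exact this
    · have hp : 0 < ‖(y : F)‖ ^ 2 := lt_of_le_of_ne (by positivity) h0.symm
      rw [← le_div_iff₀ hp]
      exact csSup_le hSne fun s hs => by rw [le_div_iff₀ hp]; exact hs y
  obtain ⟨R, hR1, hR2⟩ := hres l hllam
  have hR0 : 0 < ‖R‖ := by
    rw [norm_pos_iff]
    rintro rfl
    exact hne (by simpa using (hR2 x).symm)
  have hnew : l + ‖R‖⁻¹ ∈ S := by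
    intro y
    obtain ⟨y', hy', hAy'⟩ := hR1 (y : F)
    set s : ℝ := ‖R‖⁻¹
    have h1 := hlS (y - (s : ℂ) • y')
    have hAy : A y' = (y : F) + (l : ℂ) • (y' : F) := by rw [← hAy']; abel
    have hsy := hsymm y' y
    have e1 : (inner ℂ ((y - (s : ℂ) • y' : A.domain) : F) (A (y - (s : ℂ) • y'))).re
          - l * ‖((y - (s : ℂ) • y' : A.domain) : F)‖ ^ 2
        = ((inner ℂ (y : F) (A y)).re - l * ‖(y : F)‖ ^ 2) - 2 * s * ‖(y : F)‖ ^ 2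
          + s ^ 2 * (inner ℂ (y' : F) (y : F)).re := by
      rw [hAy] at hsy
      have hsy' := congrArg Complex.re hsy
      rw [A.map_sub, A.map_smul, hAy]
      have hn2 : ∀ z : F, ‖z‖ ^ 2 = (inner ℂ z z).re := fun z => norm_sq_eq_re_inner (𝕜 := ℂ) z
      simp only [hn2, Submodule.coe_sub, Submodule.coe_smul, inner_sub_left, inner_sub_right,
        inner_smul_left, inner_smul_right, inner_add_left, inner_add_right, Complex.conj_ofReal,
        Complex.sub_re, Complex.add_re, Complex.re_ofReal_mul] at hsy' ⊢
      linear_combination s * hsy'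
    have h2 : (inner ℂ (y' : F) (y : F)).re ≤ ‖R‖ * ‖(y : F)‖ ^ 2 := by
      calc (inner ℂ (y' : F) (y : F)).re ≤ ‖(y' : F)‖ * ‖(y : F)‖ := re_inner_le_norm (𝕜 := ℂ) _ _
        _ ≤ (‖R‖ * ‖(y : F)‖) * ‖(y : F)‖ := by gcongr; rw [hy']; exact R.le_opNorm _
        _ = _ := by ring
    have h3 : s ^ 2 * (inner ℂ (y' : F) (y : F)).re ≤ s * ‖(y : F)‖ ^ 2 := by
      calc s ^ 2 * (inner ℂ (y' : F) (y : F)).re ≤ s ^ 2 * (‖R‖ * ‖(y : F)‖ ^ 2) := by gcongr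
        _ = s * (‖R‖⁻¹ * ‖R‖) * ‖(y : F)‖ ^ 2 := by ring
        _ = _ := by rw [inv_mul_cancel₀ hR0.ne', mul_one]
    rw [add_mul]
    linarith
  have := le_csSup ⟨b, hSb⟩ hnew
  have : 0 < ‖R‖⁻¹ := by positivity
  linarith

theorem norm_sq_eq_integral (f : L2 d) : ‖f‖ ^ 2 = ∫ x, ‖f x‖ ^ 2 := by
  rw [norm_sq_eq_re_inner (𝕜 := ℂ) f, L2.inner_def]
  simp only [inner_self_eq_norm_sq_to_K]
  norm_cast

theorem integrable_norm_sq (f : L2 d) : Integrable fun x => ‖f x‖ ^ 2 :=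
  (memLp_two_iff_integrable_sq_norm (Lp.aestronglyMeasurable f)).1 (Lp.memLp f)

theorem coeFn_ballMul (a : ℝ) (f : L2 d) :
    (ballMul d a f : L2 d) =ᵐ[volume] (Metric.ball (0 : Space d) a).indicator f := by
  have h : ballMul d a f = MemLp.toLp ((Metric.ball (0 : Space d) a).indicator f)
    ((Lp.memLp f).indicator measurableSet_ball) := rfl
  rw [h]
  exact MemLp.coeFn_toLp _

theorem norm_ballMul_le (a : ℝ) (f : L2 d) : ‖ballMul d a f‖ ≤ ‖f‖ := by
  refine Lp.norm_le_norm_of_ae_le ?_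
  filter_upwards [coeFn_ballMul a f] with x hx
  rw [hx]
  exact norm_indicator_le_norm_self _ _

theorem continuous_ballMul (a : ℝ) : Continuous (ballMul d a) :=
  AddMonoidHomClass.continuous_of_bound (ballMul d a) 1 fun f => by
    rw [one_mul]; exact norm_ballMul_le a f

theorem inner_ballMul_left (a : ℝ) (f g : L2 d) :
    inner ℂ (ballMul d a f) g = inner ℂ f (ballMul d a g) := by
  rw [L2.inner_def, L2.inner_def]
  refine integral_congr_ae ?_
  filter_upwards [coeFn_ballMul a f, coeFn_ballMul a g] with x hf hg
  rw [hf, hg]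
  by_cases h : x ∈ Metric.ball (0 : Space d) a <;> simp [h]

theorem re_inner_ballMul (a : ℝ) (f : L2 d) :
    (inner ℂ f (ballMul d a f)).re
      = ∫ x, (Metric.ball (0 : Space d) a).indicator (fun x => ‖f x‖ ^ 2) x := by
  rw [L2.inner_def, ← RCLike.re_eq_complex_re, ← integral_re (L2.integrable_inner _ _)]
  refine integral_congr_ae ?_
  filter_upwards [coeFn_ballMul a f] with x hf
  rw [hf]
  by_cases h : x ∈ Metric.ball (0 : Space d) a
  · simp only [indicator_of_mem h, inner_self_eq_norm_sq_to_K]; norm_cast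
  · simp [h]

theorem relPhi_nonneg {m α z : ℝ} (hm : 0 ≤ m) (hα0 : 0 < α) (hz : 0 ≤ z) : 0 ≤ relPhi m α z := by
  have hMm : (m ^ (2 / α)) ^ (α / 2) = m := by
    rw [← Real.rpow_mul hm, div_mul_div_cancel₀ hα0.ne', div_self two_ne_zero, Real.rpow_one]
  unfold relPhi
  rw [sub_nonneg]
  calc m = (m ^ (2 / α)) ^ (α / 2) := hMm.symm
    _ ≤ _ := by gcongr; linarith

theorem continuous_relPhi {m α : ℝ} (hα0 : 0 < α) : Continuous (relPhi m α) := by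
  unfold relPhi
  exact ((continuous_id.add continuous_const).rpow_const fun _ => Or.inr (by positivity)).sub
    continuous_const

theorem symbolMul_eq (m α : ℝ) (f : L2 d) (ξ : Space d) :
    symbolMul d m α f ξ = (relPhi m α (freqSq ξ) : ℂ) * (𝓕 f : L2 d) ξ := rfl

theorem coeFn_fourier_relOp {m α : ℝ} (f : (relOp d m α).domain) :
    (𝓕 (relOp d m α f) : L2 d) =ᵐ[volume] symbolMul d m α f := by
  have : relOp d m α f = 𝓕⁻ (MemLp.toLp (symbolMul d m α f.1) f.2 : L2 d) := rfl
  rw [this, FourierTransform.fourier_fourierInv_eq]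
  exact MemLp.coeFn_toLp _

theorem inner_relOp_right {m α : ℝ} (g : L2 d) (f : (relOp d m α).domain) :
    inner ℂ g (relOp d m α f)
      = ∫ ξ, starRingEnd ℂ ((𝓕 g : L2 d) ξ) * symbolMul d m α f ξ := by
  rw [← Lp.inner_fourier_eq, L2.inner_def]
  refine integral_congr_ae ?_
  filter_upwards [coeFn_fourier_relOp f] with ξ hξ
  rw [hξ, RCLike.inner_apply, mul_comm]

theorem inner_relOp_symm {m α : ℝ} (g f : (relOp d m α).domain) :
    inner ℂ (relOp d m α g) (f : L2 d) = inner ℂ (g : L2 d) (relOp d m α f) := by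
  rw [← inner_conj_symm, inner_relOp_right, inner_relOp_right, ← integral_conj]
  congr 1; ext ξ
  simp only [symbolMul_eq, map_mul, Complex.conj_ofReal, Complex.conj_conj]
  ring

theorem re_inner_relOp {m α : ℝ} (f : (relOp d m α).domain) :
    Integrable (fun ξ => relPhi m α (freqSq ξ) * ‖(𝓕 (f : L2 d) : L2 d) ξ‖ ^ 2) ∧
    (inner ℂ (f : L2 d) (relOp d m α f)).re
      = ∫ ξ, relPhi m α (freqSq ξ) * ‖(𝓕 (f : L2 d) : L2 d) ξ‖ ^ 2 := by
  have key : ∀ ξ, (starRingEnd ℂ ((𝓕 (f : L2 d) : L2 d) ξ)) * symbolMul d m α f ξ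
      = ((relPhi m α (freqSq ξ) * ‖(𝓕 (f : L2 d) : L2 d) ξ‖ ^ 2 : ℝ) : ℂ) := fun ξ => by
    rw [symbolMul_eq, mul_left_comm, Complex.conj_mul']
    push_cast; rfl
  have hint : Integrable (fun ξ => (starRingEnd ℂ ((𝓕 (f : L2 d) : L2 d) ξ))
      * symbolMul d m α f ξ) :=
    (MemLp.star (Lp.memLp (𝓕 (f : L2 d) : L2 d))).integrable_mul f.2
  rw [inner_relOp_right]
  simp_rw [key] at hint ⊢
  refine ⟨?_, ?_⟩
  · have := hint.re
    simpa only [RCLike.re_eq_complex_re, Complex.ofReal_re] using this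
  · rw [integral_complex_ofReal, Complex.ofReal_re]

theorem schroedingerOp_apply {m α v a : ℝ} (f : (schroedingerOp d m α v a).domain) :
    schroedingerOp d m α v a f
      = relOp d m α (f : (relOp d m α).domain) - (v : ℂ) • ballMul d a (f : L2 d) := rfl

theorem inner_schroedingerOp_symm {m α v a : ℝ}
    (g f : (schroedingerOp d m α v a).domain) :
    inner ℂ (schroedingerOp d m α v a g) (f : L2 d)
      = inner ℂ (g : L2 d) (schroedingerOp d m α v a f) := by
  rw [schroedingerOp_apply, schroedingerOp_apply, inner_sub_left, inner_sub_right,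
    inner_smul_left, inner_smul_right, inner_ballMul_left, Complex.conj_ofReal]
  congr 1
  exact inner_relOp_symm g f

theorem re_inner_schroedingerOp {m α v a : ℝ} (f : (schroedingerOp d m α v a).domain) :
    (inner ℂ (f : L2 d) (schroedingerOp d m α v a f)).re
      = (∫ ξ, relPhi m α (freqSq ξ) * ‖(𝓕 (f : L2 d) : L2 d) ξ‖ ^ 2)
        - v * (inner ℂ (f : L2 d) (ballMul d a (f : L2 d))).re := by
  rw [schroedingerOp_apply, inner_sub_right, inner_smul_right, Complex.sub_re,
    Complex.re_ofReal_mul, (re_inner_relOp (m := m) (α := α) f).2]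

theorem le_re_inner_schroedingerOp {m α v a lam : ℝ} (hm : 0 ≤ m) (hα0 : 0 < α)
    (hv : 0 ≤ v) (hlam : lam ∈ lowerBounds {t : ℝ | (t : ℂ) ∈ spec (schroedingerOp d m α v a)})
    (f : (schroedingerOp d m α v a).domain) :
    lam * ‖(f : L2 d)‖ ^ 2 ≤ (inner ℂ (f : L2 d) (schroedingerOp d m α v a f)).re := by
  refine le_re_inner_of_mem_resolventSetOf _ inner_schroedingerOp_symm (c := -v) ?_ ?_ f
  · intro x
    rw [re_inner_schroedingerOp]
    have h1 : 0 ≤ ∫ ξ, relPhi m α (freqSq ξ) * ‖(𝓕 (x : L2 d) : L2 d) ξ‖ ^ 2 :=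
      integral_nonneg fun ξ => mul_nonneg (relPhi_nonneg hm hα0 (freqSq_nonneg ξ)) (by positivity)
    have h2 : (inner ℂ (x : L2 d) (ballMul d a (x : L2 d))).re ≤ ‖(x : L2 d)‖ ^ 2 := by
      calc _ ≤ ‖(x : L2 d)‖ * ‖ballMul d a (x : L2 d)‖ := re_inner_le_norm (𝕜 := ℂ) _ _
        _ ≤ ‖(x : L2 d)‖ * ‖(x : L2 d)‖ := by gcongr; exact norm_ballMul_le _ _
        _ = _ := by ring
    have := mul_le_mul_of_nonneg_left h2 hv
    linarith
  · intro t ht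
    by_contra h
    exact absurd (hlam (show (t : ℂ) ∈ spec _ from h)) (not_le.2 ht)

/-- The variational lower bound holds on the form domain: a function in the form domain is
approximated by cutting off its Fourier transform at large frequencies. -/
theorem form_lower_bound {m α v a lam : ℝ} (hm : 0 ≤ m) (hα0 : 0 < α)
    (hv : 0 ≤ v) (hlam : lam ∈ lowerBounds {t : ℝ | (t : ℂ) ∈ spec (schroedingerOp d m α v a)})
    (f : L2 d) (hf : Integrable fun ξ => relPhi m α (freqSq ξ) * ‖(𝓕 f : L2 d) ξ‖ ^ 2) :
    lam * ‖f‖ ^ 2 ≤ (∫ ξ, relPhi m α (freqSq ξ) * ‖(𝓕 f : L2 d) ξ‖ ^ 2)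
      - v * (inner ℂ f (ballMul d a f)).re := by
  set u : ℕ → L2 d := fun n => MemLp.toLp ((Metric.ball (0 : Space d) n).indicator (𝓕 f : L2 d))
    ((Lp.memLp (𝓕 f : L2 d)).indicator measurableSet_ball) with hu
  have hua : ∀ n, (u n : L2 d) =ᵐ[volume] (Metric.ball (0 : Space d) n).indicator (𝓕 f : L2 d) :=
    fun n => MemLp.coeFn_toLp _
  have hΦ0 : ∀ ξ : Space d, 0 ≤ relPhi m α (freqSq ξ) := fun ξ =>
    relPhi_nonneg hm hα0 (freqSq_nonneg ξ)
  have hΦc : Continuous fun ξ : Space d => relPhi m α (freqSq ξ) :=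
    (continuous_relPhi hα0).comp continuous_freqSq
  have hulim : Filter.Tendsto u Filter.atTop (nhds (𝓕 f : L2 d)) := by
    rw [tendsto_iff_norm_sub_tendsto_zero]
    have h2 : Filter.Tendsto (fun n => ‖u n - (𝓕 f : L2 d)‖ ^ 2) Filter.atTop (nhds 0) := by
      have e : ∀ n, ‖u n - (𝓕 f : L2 d)‖ ^ 2
          = ∫ ξ, (Metric.ball (0 : Space d) n)ᶜ.indicator (fun ξ => ‖(𝓕 f : L2 d) ξ‖ ^ 2) ξ := by
        intro n
        rw [norm_sq_eq_integral]
        refine integral_congr_ae ?_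
        filter_upwards [Lp.coeFn_sub (u n) (𝓕 f : L2 d), hua n] with ξ h1 h2
        rw [h1, Pi.sub_apply, h2]
        by_cases h : ξ ∈ Metric.ball (0 : Space d) n
        · rw [indicator_of_mem h, indicator_of_notMem (by simpa using h)]; simp
        · rw [indicator_of_notMem h, indicator_of_mem (by simpa using h)]; simp
      simp_rw [e]
      rw [show (0 : ℝ) = ∫ _ξ : Space d, (0 : ℝ) by simp]
      refine tendsto_integral_of_dominated_convergence (fun ξ => ‖(𝓕 f : L2 d) ξ‖ ^ 2) ?_
        (integrable_norm_sq _) ?_ ?_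
      · exact fun n => (integrable_norm_sq _).1.indicator measurableSet_ball.compl
      · intro n
        refine Filter.Eventually.of_forall fun ξ => ?_
        refine (norm_indicator_le_norm_self _ _).trans ?_
        rw [Real.norm_of_nonneg (by positivity)]
      · refine Filter.Eventually.of_forall fun ξ => ?_
        refine tendsto_const_nhds.congr' ?_
        obtain ⟨N, hN⟩ := exists_nat_gt ‖ξ‖
        filter_upwards [Filter.eventually_ge_atTop N] with n hn
        rw [indicator_of_notMem]
        have : (N : ℝ) ≤ n := by exact_mod_cast hn
        simp only [mem_compl_iff, Metric.mem_ball, dist_zero_right, not_not]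
        linarith
    have h3 := h2.sqrt
    simpa [Real.sqrt_sq (norm_nonneg _)] using h3
  set w : ℕ → L2 d := fun n => 𝓕⁻ (u n) with hw
  have hFw : ∀ n, (𝓕 (w n) : L2 d) = u n := fun n => FourierTransform.fourier_fourierInv_eq _
  have hwlim : Filter.Tendsto w Filter.atTop (nhds f) := by
    have := ((Lp.fourierTransformₗᵢ (Space d) ℂ).symm.continuous.tendsto (𝓕 f : L2 d)).comp hulim
    have e : (Lp.fourierTransformₗᵢ (Space d) ℂ).symm (𝓕 f : L2 d) = f :=
      (Lp.fourierTransformₗᵢ (Space d) ℂ).symm_apply_apply f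
    rw [e] at this
    exact this
  have hwdom : ∀ n, w n ∈ (schroedingerOp d m α v a).domain := by
    intro n
    change MemLp (symbolMul d m α (w n)) 2 volume
    obtain ⟨C, hC⟩ := (isCompact_closedBall (0 : Space d) n).exists_bound_of_continuousOn
      hΦc.continuousOn
    refine MemLp.of_le_mul (c := C) (Lp.memLp (u n)) ?_ ?_
    · have hm1 : AEStronglyMeasurable
          (fun ξ => (relPhi m α (freqSq ξ) : ℂ) * (𝓕 (w n) : L2 d) ξ) volume :=
        (Complex.continuous_ofReal.comp hΦc).aestronglyMeasurable.mul (Lp.aestronglyMeasurable _)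
      exact hm1
    · filter_upwards [hua n] with ξ hξ
      rw [symbolMul_eq, hFw, norm_mul, hξ]
      by_cases h : ξ ∈ Metric.ball (0 : Space d) n
      · gcongr
        rw [Complex.norm_real]
        exact hC ξ (Metric.ball_subset_closedBall h)
      · simp [h]
  have hineq : ∀ n, lam * ‖w n‖ ^ 2 ≤ (∫ ξ, relPhi m α (freqSq ξ) * ‖(𝓕 f : L2 d) ξ‖ ^ 2)
      - v * (inner ℂ (w n) (ballMul d a (w n))).re := by
    intro n
    have h1 := le_re_inner_schroedingerOp hm hα0 hv hlam ⟨w n, hwdom n⟩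
    rw [re_inner_schroedingerOp] at h1
    refine h1.trans (sub_le_sub_right ?_ _)
    refine integral_mono_ae (re_inner_relOp (⟨w n, hwdom n⟩ : (relOp d m α).domain)).1 hf ?_
    filter_upwards [hua n] with ξ hξ
    simp only [hFw, hξ]
    refine mul_le_mul_of_nonneg_left ?_ (hΦ0 ξ)
    gcongr
    exact norm_indicator_le_norm_self _ _
  refine le_of_tendsto_of_tendsto' ((hwlim.norm.pow 2).const_mul lam) ?_ hineq
  refine tendsto_const_nhds.sub (Filter.Tendsto.const_mul v ?_)
  exact (Complex.continuous_re.tendsto _).comp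
    (hwlim.inner (((continuous_ballMul a).tendsto f).comp hwlim))

/-! ### Constant phase of continuous ground states -/

theorem heat_congr_ae {f g : Space d → ℂ} (h : f =ᵐ[volume] g) (t : ℝ) : heat t f = heat t g := by
  ext x
  refine integral_congr_ae ?_
  filter_upwards [h] with y hy
  rw [hy]

theorem integrable_heatKernel_mul {t : ℝ} (ht : 0 < t) (x : Space d) {f : Space d → ℂ}
    (hf : MemLp f 2 volume) : Integrable fun y => (heatKernel t (x - y) : ℂ) * f y :=
  (memLp_heatKernel_sub ht x).integrable_mul hf

theorem integrable_heatKernel_mul_norm {t : ℝ} (ht : 0 < t) (x : Space d) {f : Space d → ℂ}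
    (hf : MemLp f 2 volume) : Integrable fun y => heatKernel t (x - y) * ‖f y‖ := by
  refine (integrable_heatKernel_mul ht x hf).norm.congr (Filter.Eventually.of_forall fun y => ?_)
  simp only [norm_mul, Complex.norm_real, Real.norm_of_nonneg (heatKernel_pos ht _).le]

theorem norm_heat_le {t : ℝ} (ht : 0 < t) (f : Space d → ℂ) (x : Space d) :
    ‖heat t f x‖ ≤ ∫ y, heatKernel t (x - y) * ‖f y‖ := by
  refine (norm_integral_le_integral_norm _).trans_eq ?_
  simp only [norm_mul, Complex.norm_real, Real.norm_of_nonneg (heatKernel_pos ht _).le]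

/-- The modulus of an `L²` function, as an element of the complex `L²` space. -/
noncomputable def absL2 (f : L2 d) : L2 d :=
  MemLp.toLp (fun x => (‖f x‖ : ℂ)) (Lp.memLp f).norm.ofReal

theorem coeFn_absL2 (f : L2 d) : (absL2 f : L2 d) =ᵐ[volume] fun x => (‖f x‖ : ℂ) :=
  MemLp.coeFn_toLp _

theorem norm_absL2 (f : L2 d) : ‖absL2 f‖ = ‖f‖ := by
  refine le_antisymm (Lp.norm_le_norm_of_ae_le ?_) (Lp.norm_le_norm_of_ae_le ?_) <;>
  · filter_upwards [coeFn_absL2 f] with x hx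
    simp [hx]

theorem heat_absL2 (t : ℝ) (f : L2 d) (x : Space d) :
    heat t (absL2 f) x = ((∫ y, heatKernel t (x - y) * ‖f y‖ : ℝ) : ℂ) := by
  rw [heat_congr_ae (coeFn_absL2 f), heat, ← integral_complex_ofReal]
  push_cast
  rfl

theorem integrable_conj_mul_heat {t : ℝ} (ht : 0 < t) (f : L2 d) :
    Integrable fun x => starRingEnd ℂ (f x) * heat t f x :=
  (MemLp.star (Lp.memLp f)).integrable_mul (memLp_heat ht f)

/-- The quadratic form of `1 - exp (tΔ)`. -/
noncomputable def heatForm (t : ℝ) (f : L2 d) : ℝ :=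
  ∫ ξ, (1 - heatSymbol t ξ) * ‖(𝓕 f : L2 d) ξ‖ ^ 2

theorem integrable_heatSymbol_mul_norm_sq {t : ℝ} (ht : 0 ≤ t) (f : L2 d) :
    Integrable fun ξ => heatSymbol t ξ * ‖(𝓕 f : L2 d) ξ‖ ^ 2 := by
  refine (integrable_norm_sq (𝓕 f : L2 d)).mono'
    ((continuous_heatSymbol t).aestronglyMeasurable.mul (integrable_norm_sq (𝓕 f : L2 d)).1) ?_
  refine Filter.Eventually.of_forall fun ξ => ?_
  have := heatSymbol_pos t ξ
  rw [Real.norm_of_nonneg (by positivity)]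
  exact mul_le_of_le_one_left (by positivity) (heatSymbol_le_one ht ξ)

theorem integrable_one_sub_heatSymbol_mul_norm_sq {t : ℝ} (ht : 0 ≤ t) (f : L2 d) :
    Integrable fun ξ => (1 - heatSymbol t ξ) * ‖(𝓕 f : L2 d) ξ‖ ^ 2 := by
  simp_rw [sub_mul, one_mul]
  exact (integrable_norm_sq _).sub (integrable_heatSymbol_mul_norm_sq ht f)

theorem heatForm_eq {t : ℝ} (ht : 0 < t) (f : L2 d) :
    heatForm t f = ‖f‖ ^ 2 - ∫ x, (starRingEnd ℂ (f x) * heat t f x).re := by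
  have h1 : ∫ x, (starRingEnd ℂ (f x) * heat t f x).re
      = ∫ ξ, heatSymbol t ξ * ‖(𝓕 f : L2 d) ξ‖ ^ 2 := by
    have h2 := integral_re (𝕜 := ℂ) (integrable_conj_mul_heat ht f)
    simp only [RCLike.re_eq_complex_re] at h2
    rw [h2, integral_conj_mul_heat ht]
    have : ∀ ξ, (starRingEnd ℂ ((𝓕 f : L2 d) ξ)) * ((heatSymbol t ξ : ℂ) * (𝓕 f : L2 d) ξ)
        = ((heatSymbol t ξ * ‖(𝓕 f : L2 d) ξ‖ ^ 2 : ℝ) : ℂ) := fun ξ => by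
      rw [mul_left_comm, Complex.conj_mul']; push_cast; rfl
    simp_rw [this]
    rw [integral_complex_ofReal, Complex.ofReal_re]
  rw [h1, ← Lp.norm_fourier_eq, norm_sq_eq_integral, heatForm,
    ← integral_sub (integrable_norm_sq _) (integrable_heatSymbol_mul_norm_sq ht.le f)]
  simp_rw [sub_mul, one_mul]

theorem re_conj_mul_heat_le {t : ℝ} (ht : 0 < t) (f : L2 d) (z : ℂ) (x : Space d) :
    (starRingEnd ℂ z * heat t f x).re ≤ ‖z‖ * ∫ y, heatKernel t (x - y) * ‖f y‖ := by
  refine (Complex.re_le_norm _).trans ?_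
  rw [norm_mul, RCLike.norm_conj]
  gcongr
  exact norm_heat_le ht _ _

theorem conj_absL2_mul_heat_ae (t : ℝ) (f : L2 d) :
    (fun x => (starRingEnd ℂ (absL2 f x) * heat t (absL2 f) x).re)
      =ᵐ[volume] fun x => ‖f x‖ * ∫ y, heatKernel t (x - y) * ‖f y‖ := by
  filter_upwards [coeFn_absL2 f] with x hx
  rw [hx, heat_absL2, Complex.conj_ofReal, ← Complex.ofReal_mul, Complex.ofReal_re]

/-- The heat form does not increase when a function is replaced by its modulus, because the heat
kernel is positive. -/
theorem heatForm_absL2_le {t : ℝ} (ht : 0 < t) (f : L2 d) : heatForm t (absL2 f) ≤ heatForm t f := by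
  rw [heatForm_eq ht, heatForm_eq ht, norm_absL2]
  refine sub_le_sub_left (integral_mono_ae (integrable_conj_mul_heat ht f).re
    (integrable_conj_mul_heat ht (absL2 f)).re ?_) _
  filter_upwards [conj_absL2_mul_heat_ae t f] with x hx
  exact (re_conj_mul_heat_le ht f _ x).trans_eq hx.symm

/-- Equality in the comparison of heat forms forces a continuous function to have a constant
phase. -/
theorem exists_phase_of_heatForm_absL2_eq {t : ℝ} (ht : 0 < t) {φ : Space d → ℂ}
    (hφ : Continuous φ) (f : L2 d) (hf : φ =ᵐ[volume] f) (hne : f ≠ 0)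
    (h : heatForm t (absL2 f) = heatForm t f) : ∃ c : ℂ, ‖c‖ = 1 ∧ ∀ x, φ x = c * ‖φ x‖ := by
  have hφm : MemLp φ 2 volume := (memLp_congr_ae hf).2 (Lp.memLp f)
  set N : Space d → ℝ := fun x => ∫ y, heatKernel t (x - y) * ‖f y‖ with hN
  have hNc : Continuous N := by
    have := Complex.continuous_re.comp (continuous_heat ht (absL2 f))
    refine this.congr fun x => ?_
    rw [Function.comp_apply, heat_absL2, Complex.ofReal_re]
  have hHc := continuous_heat ht f
  -- Equality of the integrals of two ordered continuous functions gives equality everywhere.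
  have hpt : ∀ x, ‖φ x‖ * N x - (starRingEnd ℂ (φ x) * heat t f x).re = 0 := by
    have hnn : ∀ x, 0 ≤ ‖φ x‖ * N x - (starRingEnd ℂ (φ x) * heat t f x).re := fun x =>
      sub_nonneg.2 (re_conj_mul_heat_le ht f _ x)
    have hcont : Continuous fun x => ‖φ x‖ * N x - (starRingEnd ℂ (φ x) * heat t f x).re :=
      (hφ.norm.mul hNc).sub (Complex.continuous_re.comp
        ((Complex.continuous_conj.comp hφ).mul hHc))
    have hi1 : Integrable fun x => ‖φ x‖ * N x := by
      refine (integrable_conj_mul_heat ht (absL2 f)).re.congr ?_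
      filter_upwards [conj_absL2_mul_heat_ae t f, hf] with x hx hx'
      rw [hx']; exact hx
    have hi2 : Integrable fun x => (starRingEnd ℂ (φ x) * heat t f x).re := by
      refine (integrable_conj_mul_heat ht f).re.congr ?_
      filter_upwards [hf] with x hx
      rw [hx]; rfl
    have hz : ∫ x, (‖φ x‖ * N x - (starRingEnd ℂ (φ x) * heat t f x).re) = 0 := by
      rw [integral_sub hi1 hi2, sub_eq_zero]
      rw [heatForm_eq ht, heatForm_eq ht, norm_absL2, integral_congr_ae
        (conj_absL2_mul_heat_ae t f)] at h
      have e1 : ∫ x, ‖φ x‖ * N x = ∫ x, ‖f x‖ * N x := integral_congr_ae (by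
        filter_upwards [hf] with x hx; rw [hx])
      have e2 : ∫ x, (starRingEnd ℂ (φ x) * heat t f x).re
          = ∫ x, (starRingEnd ℂ (f x) * heat t f x).re := integral_congr_ae (by
        filter_upwards [hf] with x hx; rw [hx])
      rw [e1, e2]
      linarith
    rw [integral_eq_zero_iff_of_nonneg hnn (hi1.sub hi2)] at hz
    intro x
    exact congrFun ((hcont.ae_eq_iff_eq volume continuous_zero).1 hz) x
  obtain ⟨x₁, hx₁⟩ : ∃ x, φ x ≠ 0 := by
    by_contra! hzero
    refine hne ((Lp.eq_zero_iff_ae_eq_zero).2 ?_)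
    filter_upwards [hf] with x hx
    rw [← hx, hzero x]; rfl
  have hpt2 : ∀ y, ‖φ x₁‖ * ‖φ y‖ - (starRingEnd ℂ (φ x₁) * φ y).re = 0 := by
    have hnn : ∀ y, 0 ≤ heatKernel t (x₁ - y)
        * (‖φ x₁‖ * ‖φ y‖ - (starRingEnd ℂ (φ x₁) * φ y).re) := fun y => by
      refine mul_nonneg (heatKernel_pos ht _).le (sub_nonneg.2 ?_)
      refine (Complex.re_le_norm _).trans_eq ?_
      rw [norm_mul, RCLike.norm_conj]
    have hcont : Continuous fun y => heatKernel t (x₁ - y)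
        * (‖φ x₁‖ * ‖φ y‖ - (starRingEnd ℂ (φ x₁) * φ y).re) := by fun_prop
    have hi1 := (integrable_heatKernel_mul_norm ht x₁ hφm).const_mul ‖φ x₁‖
    have hi2 := ((integrable_heatKernel_mul ht x₁ hφm).const_mul (starRingEnd ℂ (φ x₁)))
    have hsplit : ∀ y, heatKernel t (x₁ - y)
        * (‖φ x₁‖ * ‖φ y‖ - (starRingEnd ℂ (φ x₁) * φ y).re)
        = ‖φ x₁‖ * (heatKernel t (x₁ - y) * ‖φ y‖)
          - (starRingEnd ℂ (φ x₁) * ((heatKernel t (x₁ - y) : ℂ) * φ y)).re := fun y => by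
      rw [mul_left_comm _ (heatKernel t (x₁ - y) : ℂ), Complex.re_ofReal_mul]; ring
    have hz : ∫ y, heatKernel t (x₁ - y)
        * (‖φ x₁‖ * ‖φ y‖ - (starRingEnd ℂ (φ x₁) * φ y).re) = 0 := by
      simp_rw [hsplit]
      have h2 := integral_re (𝕜 := ℂ) hi2
      simp only [RCLike.re_eq_complex_re] at h2
      have hi2' : Integrable fun y =>
        (starRingEnd ℂ (φ x₁) * ((heatKernel t (x₁ - y) : ℂ) * φ y)).re := hi2.re
      rw [integral_sub hi1 hi2', h2, integral_const_mul, integral_const_mul]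
      have e1 : ∫ y, heatKernel t (x₁ - y) * ‖φ y‖ = N x₁ := integral_congr_ae (by
        filter_upwards [hf] with x hx; rw [hx])
      have e2 : ∫ y, (heatKernel t (x₁ - y) : ℂ) * φ y = heat t f x₁ := by
        rw [← heat_congr_ae hf]; rfl
      rw [e1, e2]
      exact hpt x₁
    rw [integral_eq_zero_iff_of_nonneg hnn (by simp_rw [hsplit]; exact hi1.sub hi2.re)] at hz
    intro y
    have := congrFun ((hcont.ae_eq_iff_eq volume continuous_zero).1 hz) y
    exact (mul_eq_zero.1 this).resolve_left (heatKernel_pos ht _).ne'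
  have hn1 : (‖φ x₁‖ : ℂ) ≠ 0 := by exact_mod_cast norm_ne_zero_iff.2 hx₁
  refine ⟨φ x₁ / ‖φ x₁‖, by simp [hx₁], fun y => ?_⟩
  have h1 : starRingEnd ℂ (φ x₁) * φ y = ((‖φ x₁‖ * ‖φ y‖ : ℝ) : ℂ) := by
    have h3 : (starRingEnd ℂ (φ x₁) * φ y).re = ‖starRingEnd ℂ (φ x₁) * φ y‖ := by
      rw [norm_mul, RCLike.norm_conj]; linarith [hpt2 y]
    have h4 := (Complex.re_eq_norm.1 h3)
    rw [← RCLike.norm_conj (φ x₁), ← norm_mul, ← h3]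
    refine Complex.ext ?_ ?_
    · simp
    · rw [Complex.ofReal_im]; exact (Complex.nonneg_iff.1 h4).2.symm
  have h2 : φ x₁ * (starRingEnd ℂ (φ x₁) * φ y) = (‖φ x₁‖ : ℂ) ^ 2 * φ y := by
    rw [← mul_assoc, Complex.mul_conj']
  rw [h1] at h2
  push_cast at h2
  field_simp
  refine mul_left_cancel₀ hn1 ?_
  linear_combination -h2

/-- The form of `L_{m,α}` is the integral of the heat forms against the Lévy density. -/
theorem lintegral_relPhi_mul_norm_sq {m α : ℝ} (hm : 0 ≤ m) (hα0 : 0 < α) (hα2 : α < 2)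
    (f : L2 d) :
    ∫⁻ ξ, ENNReal.ofReal (relPhi m α (freqSq ξ) * ‖(𝓕 f : L2 d) ξ‖ ^ 2)
      = ∫⁻ t in Ioi (0 : ℝ), ENNReal.ofReal (levyWeight m α t * heatForm t f) := by
  have h1 : ∀ ξ : Space d, ENNReal.ofReal (relPhi m α (freqSq ξ) * ‖(𝓕 f : L2 d) ξ‖ ^ 2)
      = ∫⁻ t in Ioi (0 : ℝ), ENNReal.ofReal
        ((1 - heatSymbol t ξ) * levyWeight m α t * ‖(𝓕 f : L2 d) ξ‖ ^ 2) := fun ξ => by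
    rw [relPhi_eq_integral hm hα0 hα2 (freqSq_nonneg ξ), ← integral_mul_const,
      ofReal_integral_eq_lintegral_ofReal]
    · rfl
    · exact (integrableOn_one_sub_exp_mul_levyWeight hm hα0 hα2 (freqSq_nonneg ξ)).mul_const _
    · refine (ae_restrict_iff' measurableSet_Ioi).2 (Filter.Eventually.of_forall fun t ht => ?_)
      have ht0 : 0 < t := ht
      have h1 := one_sub_exp_neg_nonneg (freqSq_nonneg ξ) ht0.le
      have h2 := levyWeight_pos (m := m) hα0 hα2 ht0
      simp only [Pi.zero_apply]
      positivity
  simp_rw [h1]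
  rw [lintegral_lintegral_swap]
  · refine setLIntegral_congr_fun measurableSet_Ioi fun t ht => ?_
    have ht0 : 0 < t := ht
    have h2 := levyWeight_pos (m := m) hα0 hα2 ht0
    rw [heatForm, ← integral_const_mul, ofReal_integral_eq_lintegral_ofReal]
    · congr 1; ext ξ; congr 1; ring
    · exact (integrable_one_sub_heatSymbol_mul_norm_sq ht0.le f).const_mul _
    · refine Filter.Eventually.of_forall fun ξ => ?_
      have h1 := sub_nonneg.2 (heatSymbol_le_one ht0.le ξ)
      simp only [Pi.zero_apply]
      positivity
  · refine AEMeasurable.ennreal_ofReal (AEMeasurable.mul ?_ ?_)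
    · have : Measurable fun p : Space d × ℝ => (1 - heatSymbol p.2 p.1) * levyWeight m α p.2 := by
        unfold heatSymbol
        fun_prop
      exact this.aemeasurable
    · exact ((Lp.aestronglyMeasurable (𝓕 f : L2 d)).norm.pow 2).aemeasurable.comp_fst

/-- A continuous ground state has a constant phase: its modulus has no larger energy, hence is a
minimiser as well, and equality holds for the heat forms at almost every time. -/
theorem exists_phase_of_apply_eq_smul {m α v a lam : ℝ} (hm : 0 ≤ m) (hα0 : 0 < α)
    (hα2 : α < 2) (hv : 0 ≤ v)
    (hlam : lam ∈ lowerBounds {t : ℝ | (t : ℂ) ∈ spec (schroedingerOp d m α v a)})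
    (ψ : (schroedingerOp d m α v a).domain) (hne : (ψ : L2 d) ≠ 0)
    (hψ : schroedingerOp d m α v a ψ = (lam : ℂ) • (ψ : L2 d)) {φ : Space d → ℂ}
    (hφ : Continuous φ) (hφψ : φ =ᵐ[volume] (ψ : L2 d)) :
    ∃ c : ℂ, ‖c‖ = 1 ∧ ∀ x, φ x = c * ‖φ x‖ := by
  have hΦ0 : ∀ ξ : Space d, 0 ≤ relPhi m α (freqSq ξ) := fun ξ =>
    relPhi_nonneg hm hα0 (freqSq_nonneg ξ)
  set f : L2 d := (ψ : L2 d)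
  have hint := (re_inner_relOp (m := m) (α := α) (ψ : (relOp d m α).domain)).1
  have hE : lam * ‖f‖ ^ 2 = (∫ ξ, relPhi m α (freqSq ξ) * ‖(𝓕 f : L2 d) ξ‖ ^ 2)
      - v * (inner ℂ f (ballMul d a f)).re := by
    rw [← re_inner_schroedingerOp ψ, hψ, inner_smul_right, Complex.re_ofReal_mul,
      norm_sq_eq_re_inner (𝕜 := ℂ)]
    rfl
  have hfin : ∫⁻ t in Ioi (0 : ℝ), ENNReal.ofReal (levyWeight m α t * heatForm t f) ≠ ⊤ := by
    rw [← lintegral_relPhi_mul_norm_sq hm hα0 hα2]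
    exact hint.lintegral_lt_top.ne
  have hle : ∀ᵐ t ∂(volume.restrict (Ioi (0 : ℝ))),
      ENNReal.ofReal (levyWeight m α t * heatForm t (absL2 f))
        ≤ ENNReal.ofReal (levyWeight m α t * heatForm t f) := by
    refine (ae_restrict_iff' measurableSet_Ioi).2 (Filter.Eventually.of_forall fun t ht => ?_)
    have h2 := levyWeight_pos (m := m) hα0 hα2 (show 0 < t from ht)
    gcongr
    exact heatForm_absL2_le ht f
  have hfin' : ∫⁻ t in Ioi (0 : ℝ),
      ENNReal.ofReal (levyWeight m α t * heatForm t (absL2 f)) ≠ ⊤ :=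
    ((lintegral_mono_ae hle).trans_lt (lt_top_iff_ne_top.2 hfin)).ne
  have hmeas : ∀ g : L2 d, AEStronglyMeasurable
      (fun ξ => relPhi m α (freqSq ξ) * ‖(𝓕 g : L2 d) ξ‖ ^ 2) volume := fun g =>
    ((continuous_relPhi hα0).comp continuous_freqSq).aestronglyMeasurable.mul
      ((Lp.aestronglyMeasurable _).norm.pow 2)
  have hnn : ∀ g : L2 d, 0 ≤ᵐ[volume] fun ξ => relPhi m α (freqSq ξ) * ‖(𝓕 g : L2 d) ξ‖ ^ 2 :=
    fun g => Filter.Eventually.of_forall fun ξ => mul_nonneg (hΦ0 ξ) (by positivity)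
  have hint' : Integrable fun ξ => relPhi m α (freqSq ξ) * ‖(𝓕 (absL2 f) : L2 d) ξ‖ ^ 2 := by
    refine ⟨hmeas _, ?_⟩
    rw [hasFiniteIntegral_iff_ofReal (hnn _), lintegral_relPhi_mul_norm_sq hm hα0 hα2]
    exact lt_top_iff_ne_top.2 hfin'
  have hball : (inner ℂ (absL2 f) (ballMul d a (absL2 f))).re
      = (inner ℂ f (ballMul d a f)).re := by
    rw [re_inner_ballMul, re_inner_ballMul]
    refine integral_congr_ae ?_
    filter_upwards [coeFn_absL2 f] with x hx
    by_cases h : x ∈ Metric.ball (0 : Space d) a <;> simp [h, hx]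
  have hlow := form_lower_bound hm hα0 hv hlam (absL2 f) hint'
  rw [norm_absL2, hball, hE] at hlow
  have hge : ∫⁻ t in Ioi (0 : ℝ), ENNReal.ofReal (levyWeight m α t * heatForm t f)
      ≤ ∫⁻ t in Ioi (0 : ℝ), ENNReal.ofReal (levyWeight m α t * heatForm t (absL2 f)) := by
    rw [← lintegral_relPhi_mul_norm_sq hm hα0 hα2, ← lintegral_relPhi_mul_norm_sq hm hα0 hα2,
      ← ofReal_integral_eq_lintegral_ofReal hint (hnn _),
      ← ofReal_integral_eq_lintegral_ofReal hint' (hnn _)]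
    exact ENNReal.ofReal_le_ofReal (by linarith)
  have hae := ae_eq_of_ae_le_of_lintegral_le hle hfin' ?_ hge
  · have hne0 : (volume.restrict (Ioi (0 : ℝ))) ≠ 0 := by
      rw [Ne, Measure.restrict_eq_zero]; simp
    have : (ae (volume.restrict (Ioi (0 : ℝ)))).NeBot := ae_neBot.2 hne0
    obtain ⟨t, ht1, ht2⟩ := (hae.and (ae_restrict_mem measurableSet_Ioi)).exists
    have ht0 : 0 < t := ht2
    have hk := levyWeight_pos (m := m) hα0 hα2 ht0
    have hnn2 : ∀ g : L2 d, 0 ≤ heatForm t g := fun g => integral_nonneg fun ξ =>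
      mul_nonneg (sub_nonneg.2 (heatSymbol_le_one ht0.le ξ)) (by positivity)
    rw [ENNReal.ofReal_eq_ofReal_iff (mul_nonneg hk.le (hnn2 _)) (mul_nonneg hk.le (hnn2 _))] at ht1
    exact exists_phase_of_heatForm_absL2_eq ht0 hφ f hφψ hne (mul_left_cancel₀ hk.ne' ht1)
  · refine AEMeasurable.ennreal_ofReal (measurable_levyWeight.aemeasurable.mul ?_)
    have h1 : AEStronglyMeasurable (fun p : ℝ × Space d =>
        (1 - heatSymbol p.1 p.2) * ‖(𝓕 f : L2 d) p.2‖ ^ 2)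
        ((volume.restrict (Ioi (0 : ℝ))).prod volume) := by
      refine AEStronglyMeasurable.mul ?_ ((Lp.aestronglyMeasurable (𝓕 f : L2 d)).norm.pow 2).comp_snd
      have : Measurable fun p : ℝ × Space d => (1 - heatSymbol p.1 p.2) := by
        unfold heatSymbol
        fun_prop
      exact this.aestronglyMeasurable
    exact h1.integral_prod_right'.aemeasurable

/-! ### Pointwise form of the operator on regular functions -/

theorem exists_rpow_le_mul_exp {q : ℝ} (hq : 0 ≤ q) :
    ∃ C : ℝ, 0 ≤ C ∧ ∀ s : ℝ, 0 ≤ s → s ^ q ≤ C * Real.exp s := by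
  obtain ⟨n, hn⟩ := exists_nat_ge q
  refine ⟨1 + n.factorial, by positivity, fun s hs => ?_⟩
  have h1 : 1 ≤ Real.exp s := Real.one_le_exp hs
  have h2 : s ^ n ≤ n.factorial * Real.exp s := by
    have := Real.pow_div_factorial_le_exp s hs n
    rwa [div_le_iff₀ (by positivity), mul_comm] at this
  rcases le_total s 1 with h | h
  · have : s ^ q ≤ 1 := Real.rpow_le_one hs h hq
    nlinarith [Real.exp_pos s, (Nat.cast_nonneg n.factorial : (0 : ℝ) ≤ _)]
  · have : s ^ q ≤ s ^ n := by
      rw [← Real.rpow_natCast]; exact Real.rpow_le_rpow_of_exponent_le h hn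
    linarith

/-- Powers of `‖x‖` are absorbed by the heat kernel at the cost of doubling the time. -/
theorem exists_heatKernel_mul_rpow_le {p : ℝ} (hp : 0 ≤ p) : ∃ C : ℝ, 0 ≤ C ∧
    ∀ t : ℝ, 0 < t → ∀ x : Space d,
      heatKernel t x * ‖x‖ ^ p ≤ C * t ^ (p / 2) * heatKernel (2 * t) x := by
  obtain ⟨C, hC0, hC⟩ := exists_rpow_le_mul_exp (q := p / 2) (by positivity)
  refine ⟨C * 8 ^ (p / 2) * 2 ^ ((d : ℝ) / 2), by positivity, fun t ht x => ?_⟩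
  set s := ‖x‖ ^ 2 / (8 * t) with hs
  have hs0 : 0 ≤ s := by positivity
  have e1 : ‖x‖ ^ p = 8 ^ (p / 2) * t ^ (p / 2) * s ^ (p / 2) := by
    rw [← Real.mul_rpow (by positivity) (by positivity), ← Real.mul_rpow (by positivity) hs0, hs,
      mul_div_cancel₀ _ (by positivity), ← Real.rpow_natCast, ← Real.rpow_mul (norm_nonneg _)]
    congr 1; push_cast; ring
  have e2 : heatKernel t x
      = 2 ^ ((d : ℝ) / 2) * heatKernel (2 * t) x * Real.exp (-s) := by
    have hb : (4 * Real.pi * t)⁻¹ = 2 * (4 * Real.pi * (2 * t))⁻¹ := by field_simp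
    have he : Real.exp (-(‖x‖ ^ 2 / (4 * t)))
        = Real.exp (-(‖x‖ ^ 2 / (4 * (2 * t)))) * Real.exp (-s) := by
      rw [← Real.exp_add, hs]
      congr 1
      field_simp
      ring
    rw [heatKernel, heatKernel, hb, Real.mul_rpow (by positivity) (by positivity), he]
    ring
  have hk := heatKernel_pos (d := d) (t := 2 * t) (by positivity) x
  have h3 : s ^ (p / 2) * Real.exp (-s) ≤ C := by
    calc _ ≤ C * Real.exp s * Real.exp (-s) := by gcongr; exact hC s hs0
      _ = C := by rw [mul_assoc, ← Real.exp_add]; simp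
  calc heatKernel t x * ‖x‖ ^ p
      = 8 ^ (p / 2) * t ^ (p / 2) * 2 ^ ((d : ℝ) / 2) * heatKernel (2 * t) x
          * (s ^ (p / 2) * Real.exp (-s)) := by rw [e1, e2]; ring
    _ ≤ 8 ^ (p / 2) * t ^ (p / 2) * 2 ^ ((d : ℝ) / 2) * heatKernel (2 * t) x * C := by gcongr
    _ = _ := by ring

/-- Ultracontractivity: `exp (tΔ) |f|` is bounded by a multiple of `t ^ (-d/4)`. -/
theorem integral_heatKernel_mul_norm_le {t : ℝ} (ht : 0 < t) {f : Space d → ℂ}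
    (hf : MemLp f 2 volume) (x : Space d) :
    ∫ y, heatKernel t (x - y) * ‖f y‖ ≤ (1 + ∫ y, ‖f y‖ ^ 2) * t ^ (-((d : ℝ) / 4)) := by
  have hf2 : Integrable fun y => ‖f y‖ ^ 2 := (memLp_two_iff_integrable_sq_norm hf.1).1 hf
  have hk : Integrable fun y => heatKernel t (x - y) := (integrable_heatKernel ht).comp_sub_left x
  set e := t ^ ((d : ℝ) / 4) with he
  have he0 : 0 < e := by positivity
  have hinv : t ^ (-((d : ℝ) / 4)) = e⁻¹ := by rw [Real.rpow_neg ht.le]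
  have hsup : ∀ y : Space d, heatKernel t (x - y) ≤ (e⁻¹) ^ 2 := fun y => by
    refine (heatKernel_le ht _).trans ?_
    rw [he, ← Real.inv_rpow ht.le, ← Real.rpow_natCast, ← Real.rpow_mul (by positivity)]
    calc (4 * Real.pi * t)⁻¹ ^ ((d : ℝ) / 2) ≤ t⁻¹ ^ ((d : ℝ) / 2) := by
          gcongr
          nlinarith [Real.pi_gt_three]
      _ = _ := by congr 1; push_cast; ring
  have hpt : ∀ y, heatKernel t (x - y) * ‖f y‖
      ≤ e⁻¹ * heatKernel t (x - y) + e⁻¹ * ‖f y‖ ^ 2 := fun y => by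
    have hk0 := (heatKernel_pos ht (x - y)).le
    have h1 : heatKernel t (x - y) * heatKernel t (x - y) * e
        ≤ e⁻¹ * heatKernel t (x - y) := by
      calc heatKernel t (x - y) * heatKernel t (x - y) * e
          ≤ (e⁻¹) ^ 2 * heatKernel t (x - y) * e := by gcongr; exact hsup y
        _ = e⁻¹ * (e⁻¹ * e) * heatKernel t (x - y) := by ring
        _ = _ := by rw [inv_mul_cancel₀ he0.ne', mul_one]
    have h2 : 0 ≤ e⁻¹ * (e * heatKernel t (x - y) - ‖f y‖) ^ 2 := by positivity
    have h3 : e⁻¹ * (e * heatKernel t (x - y) - ‖f y‖) ^ 2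
        = heatKernel t (x - y) * heatKernel t (x - y) * e
          - 2 * (heatKernel t (x - y) * ‖f y‖) + e⁻¹ * ‖f y‖ ^ 2 := by
      field_simp
      ring
    have h4 : 0 ≤ heatKernel t (x - y) * ‖f y‖ := by positivity
    linarith
  calc ∫ y, heatKernel t (x - y) * ‖f y‖
      ≤ ∫ y, (e⁻¹ * heatKernel t (x - y) + e⁻¹ * ‖f y‖ ^ 2) :=
        integral_mono (integrable_heatKernel_mul_norm ht x hf)
          ((hk.const_mul _).add (hf2.const_mul _)) hpt
    _ = _ := by
        rw [integral_add (hk.const_mul _) (hf2.const_mul _), integral_const_mul,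
          integral_const_mul, integral_sub_left_eq_self (heatKernel t) volume x,
          integral_heatKernel ht, hinv]
        ring

/-- Local control of symmetric second differences by `‖y‖ ^ γ`. It is the only consequence of
Hölder regularity that enters the argument, and it covers Hölder exponents `γ < 1` as well as
functions whose derivative is Hölder continuous with exponent `γ - 1`. -/
def LocSecondDiff (γ : ℝ) (φ : Space d → ℂ) : Prop :=
  ∀ R : ℝ, ∃ C : ℝ, 0 ≤ C ∧ ∀ x y : Space d, ‖x‖ ≤ R → ‖y‖ ≤ 1 →
    ‖2 * φ x - φ (x + y) - φ (x - y)‖ ≤ C * ‖y‖ ^ γ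

theorem heat_eq_integral_sub (t : ℝ) (f : Space d → ℂ) (x : Space d) :
    heat t f x = ∫ y, (heatKernel t y : ℂ) * f (x - y) := by
  rw [heat, ← integral_sub_left_eq_self _ volume x]
  simp

theorem heat_eq_integral_add (t : ℝ) (f : Space d → ℂ) (x : Space d) :
    heat t f x = ∫ y, (heatKernel t y : ℂ) * f (x + y) := by
  rw [heat_eq_integral_sub, ← integral_neg_eq_self]
  simp [heatKernel_neg]

/-- For `φ` with second differences of order `γ`, the difference `φ - exp (tΔ) φ` is of order
`t ^ (γ / 2)` for small times, locally uniformly in space. -/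
theorem exists_norm_sub_heat_le {γ : ℝ} (hγ : 0 ≤ γ) {φ : Space d → ℂ} (hφ : Continuous φ)
    (hL2 : MemLp φ 2 volume) (hreg : LocSecondDiff γ φ) (R : ℝ) :
    ∃ C : ℝ, 0 ≤ C ∧ ∀ x : Space d, ‖x‖ ≤ R → ∀ t : ℝ, 0 < t →
      ‖φ x - heat t φ x‖ ≤ C * min (t ^ (γ / 2)) 1 := by
  obtain ⟨C₀, hC₀, hreg'⟩ := hreg R
  obtain ⟨S', hS'⟩ := (isCompact_closedBall (0 : Space d) R).exists_bound_of_continuousOn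
    hφ.continuousOn
  set S := max S' 0
  have hS0 : 0 ≤ S := le_max_right _ _
  have hS : ∀ x : Space d, ‖x‖ ≤ R → ‖φ x‖ ≤ S := fun x hx =>
    (hS' x (by simpa using hx)).trans (le_max_left _ _)
  -- The exponent `N` compensates the factor `t ^ (-d/4)` of the ultracontractive bound.
  set N := γ + (d : ℝ) / 2 with hN
  have hN0 : 0 ≤ N := by positivity
  obtain ⟨C₁, hC₁, h1⟩ := exists_heatKernel_mul_rpow_le (d := d) hγ
  obtain ⟨C₂, hC₂, h2⟩ := exists_heatKernel_mul_rpow_le (d := d) hN0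
  set A := 1 + ∫ y, ‖φ y‖ ^ 2 with hA
  have hA0 : 0 ≤ A := by
    have : 0 ≤ ∫ y, ‖φ y‖ ^ 2 := integral_nonneg fun y => by positivity
    linarith
  set B := (C₀ + 2 * S) * C₁ + 2 * (C₂ * A) with hB
  have hB0 : 0 ≤ B := by positivity
  have hsmall : ∀ x : Space d, ‖x‖ ≤ R → ∀ t : ℝ, 0 < t →
      ‖φ x - heat t φ x‖ ≤ B * t ^ (γ / 2) := by
    intro x hx t ht
    have ht2 : 0 < 2 * t := by positivity
    have i0 : Integrable fun y : Space d => (heatKernel t y : ℂ) * φ x :=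
      (integrable_heatKernel ht).ofReal.mul_const _
    have isub : ∀ s : ℝ, 0 < s → Integrable fun y : Space d => (heatKernel s y : ℂ) * φ (x - y) :=
      fun s hs => by
        have := (integrable_heatKernel_mul hs x hL2).comp_sub_left x
        simpa using this
    have iadd : ∀ s : ℝ, 0 < s → Integrable fun y : Space d => (heatKernel s y : ℂ) * φ (x + y) :=
      fun s hs => by
        have := (isub s hs).comp_neg
        simpa [heatKernel_neg] using this
    have hnorm : ∀ s : ℝ, 0 < s → ∀ (y : Space d) (z : ℂ),
        ‖(heatKernel s y : ℂ) * z‖ = heatKernel s y * ‖z‖ := fun s hs y z => by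
      rw [norm_mul, Complex.norm_real, Real.norm_of_nonneg (heatKernel_pos hs _).le]
    have jsub : Integrable fun y : Space d => heatKernel (2 * t) y * ‖φ (x - y)‖ := by
      simpa only [hnorm _ ht2] using (isub _ ht2).norm
    have jadd : Integrable fun y : Space d => heatKernel (2 * t) y * ‖φ (x + y)‖ := by
      simpa only [hnorm _ ht2] using (iadd _ ht2).norm
    have hint : 2 * (φ x - heat t φ x)
        = ∫ y, (heatKernel t y : ℂ) * (2 * φ x - φ (x + y) - φ (x - y)) := by
      have e : ∀ y : Space d, (heatKernel t y : ℂ) * (2 * φ x - φ (x + y) - φ (x - y))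
          = 2 * ((heatKernel t y : ℂ) * φ x) - (heatKernel t y : ℂ) * φ (x + y)
            - (heatKernel t y : ℂ) * φ (x - y) := fun y => by ring
      simp_rw [e]
      have i1 : Integrable fun y : Space d =>
          2 * ((heatKernel t y : ℂ) * φ x) - (heatKernel t y : ℂ) * φ (x + y) :=
        (i0.const_mul 2).sub (iadd t ht)
      rw [integral_sub i1 (isub t ht), integral_sub (i0.const_mul 2) (iadd t ht), ← heat_eq_integral_add,
        ← heat_eq_integral_sub, integral_const_mul, integral_mul_const, integral_complex_ofReal,
        integral_heatKernel ht]
      push_cast; ring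
    have hD : ∀ y : Space d, ‖2 * φ x - φ (x + y) - φ (x - y)‖
        ≤ (C₀ + 2 * S) * ‖y‖ ^ γ + ‖y‖ ^ N * (‖φ (x + y)‖ + ‖φ (x - y)‖) := fun y => by
      rcases le_total ‖y‖ 1 with hy | hy
      · refine (hreg' x y hx hy).trans ?_
        have h3 : 0 ≤ ‖y‖ ^ N * (‖φ (x + y)‖ + ‖φ (x - y)‖) := by positivity
        have h4 : C₀ * ‖y‖ ^ γ ≤ (C₀ + 2 * S) * ‖y‖ ^ γ := by gcongr; linarith
        linarith
      · have h3 : 1 ≤ ‖y‖ ^ N := Real.one_le_rpow hy hN0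
        have h4 : 1 ≤ ‖y‖ ^ γ := Real.one_le_rpow hy hγ
        have h5 : ‖2 * φ x - φ (x + y) - φ (x - y)‖ ≤ 2 * S + ‖φ (x + y)‖ + ‖φ (x - y)‖ := by
          refine (norm_sub_le _ _).trans ?_
          gcongr
          refine (norm_sub_le _ _).trans ?_
          gcongr
          rw [norm_mul, Complex.norm_ofNat]
          gcongr
          exact hS x hx
        have h6 : 2 * S ≤ (C₀ + 2 * S) * ‖y‖ ^ γ := by nlinarith
        have h7 : ‖φ (x + y)‖ + ‖φ (x - y)‖ ≤ ‖y‖ ^ N * (‖φ (x + y)‖ + ‖φ (x - y)‖) :=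
          le_mul_of_one_le_left (by positivity) h3
        linarith
    have hpt : ∀ y : Space d, ‖(heatKernel t y : ℂ) * (2 * φ x - φ (x + y) - φ (x - y))‖
        ≤ (C₀ + 2 * S) * C₁ * t ^ (γ / 2) * heatKernel (2 * t) y
          + C₂ * t ^ (N / 2) * (heatKernel (2 * t) y * ‖φ (x + y)‖
            + heatKernel (2 * t) y * ‖φ (x - y)‖) := fun y => by
      rw [hnorm t ht]
      have hk0 := (heatKernel_pos ht y).le
      calc heatKernel t y * ‖2 * φ x - φ (x + y) - φ (x - y)‖
          ≤ heatKernel t y * ((C₀ + 2 * S) * ‖y‖ ^ γ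
              + ‖y‖ ^ N * (‖φ (x + y)‖ + ‖φ (x - y)‖)) := by gcongr; exact hD y
        _ = (C₀ + 2 * S) * (heatKernel t y * ‖y‖ ^ γ)
              + (heatKernel t y * ‖y‖ ^ N) * (‖φ (x + y)‖ + ‖φ (x - y)‖) := by ring
        _ ≤ (C₀ + 2 * S) * (C₁ * t ^ (γ / 2) * heatKernel (2 * t) y)
              + (C₂ * t ^ (N / 2) * heatKernel (2 * t) y) * (‖φ (x + y)‖ + ‖φ (x - y)‖) := by
            exact add_le_add (mul_le_mul_of_nonneg_left (h1 t ht y) (by positivity))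
              (mul_le_mul_of_nonneg_right (h2 t ht y) (by positivity))
        _ = _ := by ring
    have hk2 := integrable_heatKernel (d := d) ht2
    have htail : (2 * t) ^ (-((d : ℝ) / 4)) ≤ t ^ (-((d : ℝ) / 4)) :=
      Real.rpow_le_rpow_of_nonpos ht (by linarith) (by
        rw [neg_nonpos]; positivity)
    have tsub : ∫ y : Space d, heatKernel (2 * t) y * ‖φ (x - y)‖ ≤ A * t ^ (-((d : ℝ) / 4)) := by
      rw [← integral_sub_left_eq_self _ volume x]
      simp only [sub_sub_cancel]
      exact (integral_heatKernel_mul_norm_le ht2 hL2 x).trans (by gcongr)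
    have tadd : ∫ y : Space d, heatKernel (2 * t) y * ‖φ (x + y)‖ ≤ A * t ^ (-((d : ℝ) / 4)) := by
      rw [← integral_neg_eq_self]
      simp only [heatKernel_neg, ← sub_eq_add_neg]
      exact tsub
    have hfinal : ‖2 * (φ x - heat t φ x)‖ ≤ B * t ^ (γ / 2) := by
      rw [hint]
      calc _ ≤ ∫ y, ((C₀ + 2 * S) * C₁ * t ^ (γ / 2) * heatKernel (2 * t) y
          + C₂ * t ^ (N / 2) * (heatKernel (2 * t) y * ‖φ (x + y)‖
            + heatKernel (2 * t) y * ‖φ (x - y)‖)) :=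
            norm_integral_le_of_norm_le ((hk2.const_mul _).add ((jadd.add jsub).const_mul _))
              (Filter.Eventually.of_forall hpt)
        _ = (C₀ + 2 * S) * C₁ * t ^ (γ / 2)
            + C₂ * t ^ (N / 2) * ((∫ y : Space d, heatKernel (2 * t) y * ‖φ (x + y)‖)
              + ∫ y : Space d, heatKernel (2 * t) y * ‖φ (x - y)‖) := by
            have j1 : Integrable fun y : Space d => heatKernel (2 * t) y * ‖φ (x + y)‖
              + heatKernel (2 * t) y * ‖φ (x - y)‖ := jadd.add jsub
            rw [integral_add (hk2.const_mul _) (j1.const_mul _), integral_const_mul,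
              integral_const_mul, integral_heatKernel ht2, mul_one, integral_add jadd jsub]
        _ ≤ (C₀ + 2 * S) * C₁ * t ^ (γ / 2)
            + C₂ * t ^ (N / 2) * (A * t ^ (-((d : ℝ) / 4)) + A * t ^ (-((d : ℝ) / 4))) := by
            gcongr
        _ = (C₀ + 2 * S) * C₁ * t ^ (γ / 2)
            + 2 * (C₂ * A) * (t ^ (N / 2) * t ^ (-((d : ℝ) / 4))) := by ring
        _ = _ := by
            rw [← Real.rpow_add ht, hN, hB]
            rw [show (γ + (d : ℝ) / 2) / 2 + -((d : ℝ) / 4) = γ / 2 by ring]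
            ring
    rw [norm_mul, Complex.norm_ofNat] at hfinal
    linarith [norm_nonneg (φ x - heat t φ x)]
  refine ⟨max B (S + A), le_max_of_le_left hB0, fun x hx t ht => ?_⟩
  rcases le_total t 1 with h | h
  · rw [min_eq_left (Real.rpow_le_one ht.le h (by positivity))]
    exact (hsmall x hx t ht).trans (by gcongr; exact le_max_left _ _)
  · rw [min_eq_right (Real.one_le_rpow h (by positivity)), mul_one]
    refine le_trans ?_ (le_max_right _ _)
    refine (norm_sub_le _ _).trans (add_le_add (hS x hx) ?_)
    refine (norm_heat_le ht φ x).trans ((integral_heatKernel_mul_norm_le ht hL2 x).trans ?_)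
    exact mul_le_of_le_one_right hA0 (Real.rpow_le_one_of_one_le_of_nonpos h (by
      rw [neg_nonpos]; positivity))

theorem stronglyMeasurable_heat {φ : Space d → ℂ} (hφ : Continuous φ) :
    StronglyMeasurable fun p : Space d × ℝ => heat p.2 φ p.1 := by
  have hm : Measurable fun q : (Space d × ℝ) × Space d =>
      (heatKernel q.1.2 (q.1.1 - q.2) : ℂ) * φ q.2 := by
    have := hφ.measurable
    unfold heatKernel
    fun_prop
  exact hm.stronglyMeasurable.integral_prod_right'

/-- The operator `L_{m,α}` in pointwise form, as an average of `1 - exp (tΔ)` over the Lévy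
density. -/
noncomputable def levyOp (m α : ℝ) (φ : Space d → ℂ) (x : Space d) : ℂ :=
  ∫ t in Ioi (0 : ℝ), (levyWeight m α t : ℂ) * (φ x - heat t φ x)

section levyOp

variable {m α γ : ℝ} {φ : Space d → ℂ}

theorem aestronglyMeasurable_levyOp_integrand (hφ : Continuous φ) (x : Space d) (μ : Measure ℝ) :
    AEStronglyMeasurable (fun t => (levyWeight m α t : ℂ) * (φ x - heat t φ x)) μ := by
  have h1 : StronglyMeasurable fun t => heat t φ x :=
    (stronglyMeasurable_heat hφ).comp_measurable (measurable_const.prodMk measurable_id)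
  have h2 : Measurable fun t => (levyWeight m α t : ℂ) := by fun_prop
  exact (h2.stronglyMeasurable.mul (stronglyMeasurable_const.sub h1)).aestronglyMeasurable

theorem exists_levyOp_bound (hm : 0 ≤ m) (hα0 : 0 < α) (hα2 : α < 2) (hγ : α < γ)
    (hφ : Continuous φ) (hL2 : MemLp φ 2 volume) (hreg : LocSecondDiff γ φ) (R : ℝ) :
    ∃ b : ℝ → ℝ, IntegrableOn b (Ioi 0) ∧ ∀ x : Space d, ‖x‖ ≤ R → ∀ t : ℝ, 0 < t →
      ‖(levyWeight m α t : ℂ) * (φ x - heat t φ x)‖ ≤ b t := by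
  obtain ⟨C, hC0, hC⟩ := exists_norm_sub_heat_le (hα0.trans hγ).le hφ hL2 hreg R
  refine ⟨fun t => C * (min (t ^ (γ / 2)) 1 * levyWeight m α t),
    (integrableOn_min_rpow_mul_levyWeight hm hα0 hα2 (by linarith)).const_mul C,
    fun x hx t ht => ?_⟩
  have hk := levyWeight_pos (m := m) hα0 hα2 ht
  rw [norm_mul, Complex.norm_real, Real.norm_of_nonneg hk.le]
  calc levyWeight m α t * ‖φ x - heat t φ x‖
      ≤ levyWeight m α t * (C * min (t ^ (γ / 2)) 1) := by gcongr; exact hC x hx t ht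
    _ = _ := by ring

theorem integrableOn_levyOp_integrand (hm : 0 ≤ m) (hα0 : 0 < α) (hα2 : α < 2) (hγ : α < γ)
    (hφ : Continuous φ) (hL2 : MemLp φ 2 volume) (hreg : LocSecondDiff γ φ) (x : Space d) :
    IntegrableOn (fun t => (levyWeight m α t : ℂ) * (φ x - heat t φ x)) (Ioi 0) := by
  obtain ⟨b, hb, hle⟩ := exists_levyOp_bound (m := m) hm hα0 hα2 hγ hφ hL2 hreg ‖x‖
  exact hb.mono' (aestronglyMeasurable_levyOp_integrand hφ x _)
    ((ae_restrict_iff' measurableSet_Ioi).2 (Filter.Eventually.of_forall fun t ht =>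
      hle x le_rfl t ht))

theorem continuous_levyOp (hm : 0 ≤ m) (hα0 : 0 < α) (hα2 : α < 2) (hγ : α < γ)
    (hφ : Continuous φ) (f : L2 d) (hf : φ =ᵐ[volume] f) (hreg : LocSecondDiff γ φ) :
    Continuous (levyOp m α φ) := by
  have hL2 : MemLp φ 2 volume := (memLp_congr_ae hf).2 (Lp.memLp f)
  rw [continuous_iff_continuousAt]
  intro x₀
  obtain ⟨b, hb, hle⟩ := exists_levyOp_bound (m := m) hm hα0 hα2 hγ hφ hL2 hreg (‖x₀‖ + 1)
  refine continuousAt_of_dominated (bound := b) (Filter.Eventually.of_forall fun x =>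
    aestronglyMeasurable_levyOp_integrand hφ x _) ?_ hb ?_
  · filter_upwards [Metric.ball_mem_nhds x₀ one_pos] with x hx
    refine (ae_restrict_iff' measurableSet_Ioi).2 (Filter.Eventually.of_forall fun t ht => ?_)
    refine hle x ?_ t ht
    rw [Metric.mem_ball, dist_eq_norm] at hx
    have := norm_le_norm_add_norm_sub' x x₀
    linarith
  · refine (ae_restrict_iff' measurableSet_Ioi).2 (Filter.Eventually.of_forall fun t ht => ?_)
    have h1 := continuous_heat (show 0 < t from ht) f
    rw [← heat_congr_ae hf] at h1
    exact (continuous_const.mul (hφ.sub h1)).continuousAt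

/-- The pointwise operator represents the Fourier multiplier: both have the same integrals against
test functions, by Plancherel's identity at each time and Fubini's theorem. -/
theorem levyOp_ae_eq_relOp (hm : 0 ≤ m) (hα0 : 0 < α) (hα2 : α < 2) (hγ : α < γ)
    (hφ : Continuous φ) (f : (relOp d m α).domain) (hf : φ =ᵐ[volume] (f : L2 d))
    (hreg : LocSecondDiff γ φ) : levyOp m α φ =ᵐ[volume] (relOp d m α f : L2 d) := by
  have hL2 : MemLp φ 2 volume := (memLp_congr_ae hf).2 (Lp.memLp _)
  refine ae_eq_of_integral_contDiff_smul_eq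
    (continuous_levyOp hm hα0 hα2 hγ hφ f hf hreg).locallyIntegrable
    ((Lp.memLp _).locallyIntegrable (by norm_num)) ?_
  intro g g_smooth g_cpt
  have hgL2 : MemLp (fun x => (g x : ℂ)) 2 volume :=
    (g_smooth.continuous.memLp_of_hasCompactSupport g_cpt).ofReal
  set G : L2 d := hgL2.toLp _ with hG
  have hGae : (G : L2 d) =ᵐ[volume] fun x => (g x : ℂ) := hgL2.coeFn_toLp
  set K : ℝ → Space d → ℂ := fun t x => (g x : ℂ) * ((levyWeight m α t : ℂ) * (φ x - heat t φ x))
  set M : ℝ → Space d → ℂ := fun t ξ => (((1 - heatSymbol t ξ) * levyWeight m α t : ℝ) : ℂ)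
    * (starRingEnd ℂ ((𝓕 G : L2 d) ξ) * (𝓕 (f : L2 d) : L2 d) ξ)
  -- Plancherel's identity at a fixed time.
  have hPl : ∀ t : ℝ, 0 < t → ∫ x, K t x = ∫ ξ, M t ξ := by
    intro t ht
    have hheat : heat t φ = heat t (f : L2 d) := heat_congr_ae hf t
    have i1 : Integrable fun x => starRingEnd ℂ (G x) * (f : L2 d) x :=
      (MemLp.star (Lp.memLp G)).integrable_mul (Lp.memLp _)
    have i2 : Integrable fun x => starRingEnd ℂ (G x) * heat t (f : L2 d) x :=
      (MemLp.star (Lp.memLp G)).integrable_mul (memLp_heat ht _)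
    have j1 : Integrable fun ξ => starRingEnd ℂ ((𝓕 G : L2 d) ξ) * (𝓕 (f : L2 d) : L2 d) ξ :=
      (MemLp.star (Lp.memLp (𝓕 G : L2 d))).integrable_mul (Lp.memLp _)
    have j2 : Integrable fun ξ => starRingEnd ℂ ((𝓕 G : L2 d) ξ)
        * ((heatSymbol t ξ : ℂ) * (𝓕 (f : L2 d) : L2 d) ξ) :=
      (MemLp.star (Lp.memLp (𝓕 G : L2 d))).integrable_mul (memLp_heatSymbol_mul ht.le _)
    have e1 : ∫ x, K t x = (levyWeight m α t : ℂ)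
        * ((∫ x, starRingEnd ℂ (G x) * (f : L2 d) x)
          - ∫ x, starRingEnd ℂ (G x) * heat t (f : L2 d) x) := by
      rw [← integral_sub i1 i2, ← integral_const_mul]
      refine integral_congr_ae ?_
      filter_upwards [hGae, hf] with x h1 h2
      simp only [K, h1, hheat, h2, Complex.conj_ofReal]
      ring
    have e2 : ∫ x, starRingEnd ℂ (G x) * (f : L2 d) x
        = ∫ ξ, starRingEnd ℂ ((𝓕 G : L2 d) ξ) * (𝓕 (f : L2 d) : L2 d) ξ := by
      have := Lp.inner_fourier_eq G (f : L2 d)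
      rw [L2.inner_def, L2.inner_def] at this
      simp only [RCLike.inner_apply'] at this
      exact this.symm
    rw [e1, e2, integral_conj_mul_heat ht, ← integral_sub j1 j2, ← integral_const_mul]
    congr 1; ext ξ
    simp only [M]
    push_cast
    ring
  have hKint : Integrable (Function.uncurry fun x t => K t x)
      ((volume : Measure (Space d)).prod (volume.restrict (Ioi (0 : ℝ)))) := by
    obtain ⟨R, hR⟩ := g_cpt.isCompact.isBounded.subset_closedBall (0 : Space d)
    obtain ⟨b, hb, hle⟩ := exists_levyOp_bound (m := m) hm hα0 hα2 hγ hφ hL2 hreg R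
    have hgi : Integrable g := g_smooth.continuous.integrable_of_hasCompactSupport g_cpt
    refine (hgi.norm.mul_prod hb).mono' ?_ ?_
    · have h1 := stronglyMeasurable_heat hφ
      have h2 : Measurable fun p : Space d × ℝ => (levyWeight m α p.2 : ℂ) := by fun_prop
      have h3 : Continuous fun p : Space d × ℝ => (g p.1 : ℂ) :=
        Complex.continuous_ofReal.comp (g_smooth.continuous.comp continuous_fst)
      have h4 : Continuous fun p : Space d × ℝ => φ p.1 := hφ.comp continuous_fst
      exact (h3.stronglyMeasurable.mul
        (h2.stronglyMeasurable.mul (h4.stronglyMeasurable.sub h1))).aestronglyMeasurable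
    · have hmem : ∀ᵐ p : Space d × ℝ ∂((volume : Measure (Space d)).prod
          (volume.restrict (Ioi (0 : ℝ)))), p.2 ∈ Ioi (0 : ℝ) :=
        Measure.quasiMeasurePreserving_snd.ae (ae_restrict_mem measurableSet_Ioi)
      filter_upwards [hmem] with p hp
      simp only [Function.uncurry, K]
      rw [norm_mul, Complex.norm_real]
      by_cases hx : p.1 ∈ tsupport g
      · gcongr
        exact hle p.1 (by simpa using hR hx) p.2 hp
      · simp [image_eq_zero_of_notMem_tsupport hx]
  have hΦ : ∀ ξ : Space d, ∫ t in Ioi (0 : ℝ), ‖M t ξ‖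
      = ‖starRingEnd ℂ ((𝓕 G : L2 d) ξ) * symbolMul d m α f ξ‖ := by
    intro ξ
    rw [symbolMul_eq, norm_mul, norm_mul, Complex.norm_real,
      Real.norm_of_nonneg (relPhi_nonneg hm hα0 (freqSq_nonneg ξ)),
      relPhi_eq_integral hm hα0 hα2 (freqSq_nonneg ξ), mul_left_comm, ← integral_mul_const]
    refine setIntegral_congr_fun measurableSet_Ioi fun t ht => ?_
    have hk := levyWeight_pos (m := m) hα0 hα2 (show 0 < t from ht)
    simp only [M]
    rw [norm_mul, Complex.norm_real, Real.norm_of_nonneg (mul_nonneg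
      (sub_nonneg.2 (heatSymbol_le_one (le_of_lt ht) ξ)) hk.le), norm_mul]
    rfl
  have hMint : Integrable (Function.uncurry fun ξ t => M t ξ)
      ((volume : Measure (Space d)).prod (volume.restrict (Ioi (0 : ℝ)))) := by
    have hmeas : AEStronglyMeasurable (Function.uncurry fun ξ t => M t ξ)
        ((volume : Measure (Space d)).prod (volume.restrict (Ioi (0 : ℝ)))) := by
      refine AEStronglyMeasurable.mul ?_ ?_
      · have : Measurable fun p : Space d × ℝ =>
            (((1 - heatSymbol p.2 p.1) * levyWeight m α p.2 : ℝ) : ℂ) := by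
          unfold heatSymbol
          fun_prop
        exact this.aestronglyMeasurable
      · exact ((MemLp.star (Lp.memLp (𝓕 G : L2 d))).1.mul
          (Lp.memLp (𝓕 (f : L2 d) : L2 d)).1).comp_fst
    rw [integrable_prod_iff hmeas]
    refine ⟨Filter.Eventually.of_forall fun ξ => ?_, ?_⟩
    · have h1 : Integrable (fun t => (((1 - heatSymbol t ξ) * levyWeight m α t : ℝ) : ℂ))
          (volume.restrict (Ioi (0 : ℝ))) :=
        (integrableOn_one_sub_exp_mul_levyWeight hm hα0 hα2 (freqSq_nonneg ξ)).ofReal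
      exact h1.mul_const (starRingEnd ℂ ((𝓕 G : L2 d) ξ) * (𝓕 (f : L2 d) : L2 d) ξ)
    · simp only [Function.uncurry, hΦ]
      exact ((MemLp.star (Lp.memLp (𝓕 G : L2 d))).integrable_mul f.2).norm
  calc ∫ x, g x • levyOp m α φ x
      = ∫ x, ∫ t in Ioi (0 : ℝ), K t x := by
        congr 1; ext x
        rw [levyOp, Complex.real_smul, ← integral_const_mul]
    _ = ∫ t in Ioi (0 : ℝ), ∫ x, K t x := integral_integral_swap hKint
    _ = ∫ t in Ioi (0 : ℝ), ∫ ξ, M t ξ :=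
        setIntegral_congr_fun measurableSet_Ioi fun t ht => hPl t ht
    _ = ∫ ξ, ∫ t in Ioi (0 : ℝ), M t ξ := (integral_integral_swap hMint).symm
    _ = ∫ ξ, starRingEnd ℂ ((𝓕 G : L2 d) ξ) * symbolMul d m α f ξ := by
        congr 1; ext ξ
        rw [symbolMul_eq, relPhi_eq_integral hm hα0 hα2 (freqSq_nonneg ξ), mul_left_comm,
          ← integral_complex_ofReal, ← integral_mul_const]
        rfl
    _ = inner ℂ G (relOp d m α f) := (inner_relOp_right G f).symm
    _ = ∫ x, g x • (relOp d m α f : L2 d) x := by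
        rw [L2.inner_def]
        refine integral_congr_ae ?_
        filter_upwards [hGae] with x hx
        rw [hx, RCLike.inner_apply', Complex.conj_ofReal, Complex.real_smul]

end levyOp

/-! ### Behaviour on the sphere -/

theorem LocHolder.continuous {Y : Type*} [NormedAddCommGroup Y] {γ : ℝ≥0} (hγ : 0 < γ)
    {f : Space d → Y} (hf : LocHolder γ f) : Continuous f := by
  rw [continuous_iff_continuousAt]
  intro x
  obtain ⟨C, hC⟩ := hf (Metric.closedBall x 1) (isCompact_closedBall x 1)
  exact (hC.continuousOn hγ).continuousAt (Metric.closedBall_mem_nhds x one_pos)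

theorem add_mem_closedBall_add_one {R : ℝ} {x y : Space d} (hx : ‖x‖ ≤ R) (hy : ‖y‖ ≤ 1) :
    x + y ∈ Metric.closedBall (0 : Space d) (R + 1) := by
  rw [mem_closedBall_zero_iff]
  exact (norm_add_le x y).trans (add_le_add hx hy)

theorem LocHolder.locSecondDiff {γ : ℝ≥0} {f : Space d → ℂ} (hf : LocHolder γ f) :
    LocSecondDiff γ f := by
  intro R
  obtain ⟨C, hC⟩ := hf (Metric.closedBall 0 (R + 1)) (isCompact_closedBall 0 (R + 1))
  refine ⟨2 * C, by positivity, fun x y hx hy => ?_⟩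
  have hxm : x ∈ Metric.closedBall (0 : Space d) (R + 1) := by
    rw [mem_closedBall_zero_iff]; linarith
  have key : ∀ z : Space d, ‖z‖ ≤ 1 → ‖f x - f (x + z)‖ ≤ C * ‖z‖ ^ (γ : ℝ) := fun z hz => by
    have := hC.dist_le hxm (add_mem_closedBall_add_one hx hz)
    simpa [dist_eq_norm] using this
  have h1 := key y hy
  have h2 := key (-y) (by rwa [norm_neg])
  rw [norm_neg, ← sub_eq_add_neg] at h2
  calc ‖2 * f x - f (x + y) - f (x - y)‖ = ‖(f x - f (x + y)) + (f x - f (x - y))‖ := by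
        congr 1; ring
    _ ≤ C * ‖y‖ ^ (γ : ℝ) + C * ‖y‖ ^ (γ : ℝ) := (norm_add_le _ _).trans (add_le_add h1 h2)
    _ = _ := by ring

theorem LocC1Holder.locSecondDiff {γ : ℝ≥0} {f : Space d → ℂ}
    (hf : LocC1Holder γ f) : LocSecondDiff (γ + 1) f := by
  intro R
  obtain ⟨C, hC⟩ := hf.2 (Metric.closedBall 0 (R + 1)) (isCompact_closedBall 0 (R + 1))
  refine ⟨2 * C, by positivity, fun x y hx hy => ?_⟩
  have hxm : x ∈ Metric.closedBall (0 : Space d) (R + 1) := by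
    rw [mem_closedBall_zero_iff]; linarith
  have hdiff : Differentiable ℝ f := hf.1.differentiable one_ne_zero
  -- First-order Taylor expansion at `x`, with the remainder bounded by the mean value inequality.
  have key : ∀ z : Space d, ‖z‖ ≤ 1 →
      ‖f (x + z) - f x - fderiv ℝ f x z‖ ≤ C * ‖z‖ ^ ((γ : ℝ) + 1) := fun z hz => by
    have := (convex_closedBall x ‖z‖).norm_image_sub_le_of_norm_fderiv_le' (𝕜 := ℝ) (f := f)
      (φ := fderiv ℝ f x) (C := C * ‖z‖ ^ (γ : ℝ)) (x := x) (y := x + z)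
      (fun w _ => hdiff w) (fun w hw => by
        rw [mem_closedBall_iff_norm] at hw
        have hwm : w ∈ Metric.closedBall (0 : Space d) (R + 1) := by
          have := add_mem_closedBall_add_one hx (hw.trans hz)
          rwa [add_sub_cancel] at this
        have h1 := hC.dist_le hwm hxm
        rw [dist_eq_norm, dist_eq_norm] at h1
        exact h1.trans (by gcongr)) (Metric.mem_closedBall_self (norm_nonneg z))
      (by simp)
    rw [add_sub_cancel_left] at this
    refine this.trans_eq ?_
    rcases eq_or_ne ‖z‖ 0 with h0 | h0
    · have : (γ : ℝ) + 1 ≠ 0 := by positivity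
      rw [h0, Real.zero_rpow this]; ring
    · rw [Real.rpow_add_one h0]; ring
  have h1 := key y hy
  have h2 := key (-y) (by rwa [norm_neg])
  rw [norm_neg, ← sub_eq_add_neg, map_neg] at h2
  calc ‖2 * f x - f (x + y) - f (x - y)‖
      = ‖(f (x + y) - f x - fderiv ℝ f x y) + (f (x - y) - f x - -fderiv ℝ f x y)‖ := by
        rw [← norm_neg]; congr 1; ring
    _ ≤ C * ‖y‖ ^ ((γ : ℝ) + 1) + C * ‖y‖ ^ ((γ : ℝ) + 1) :=
        (norm_add_le _ _).trans (add_le_add h1 h2)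
    _ = _ := by ring

/-- The jump of the potential: if `F` and `φ` are continuous and `F = (lam + v 1_{B_a}) φ` almost
everywhere, then both vanish on the sphere of radius `a`. -/
theorem eq_zero_of_mem_sphere {F φ : Space d → ℂ} {lam v a : ℝ} (hv : v ≠ 0) (ha : 0 < a)
    (hF : Continuous F) (hφ : Continuous φ)
    (h : F =ᵐ[volume] fun x => (lam : ℂ) * φ x
      + (v : ℂ) * (Metric.ball (0 : Space d) a).indicator φ x) {x : Space d} (hx : ‖x‖ = a) :
    φ x = 0 ∧ F x = 0 := by
  have hnt : Nontrivial (Space d) := ⟨x, 0, by rintro rfl; simp at hx; linarith⟩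
  have hsphere : ∀ᵐ y : Space d, y ∉ Metric.sphere (0 : Space d) a :=
    measure_eq_zero_iff_ae_notMem.1 (Measure.addHaar_sphere volume 0 a)
  have hin : F x = (lam : ℂ) * φ x + (v : ℂ) * φ x := by
    refine Measure.eqOn_of_ae_eq (μ := volume) (s := Metric.closedBall (0 : Space d) a)
      (f := F) (g := fun x => (lam : ℂ) * φ x + (v : ℂ) * φ x) ?_ hF.continuousOn
      (by fun_prop) ?_ (by simp [hx])
    · refine (ae_restrict_iff' measurableSet_closedBall).2 ?_
      filter_upwards [h, hsphere] with y hy hys hyb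
      have : y ∈ Metric.ball (0 : Space d) a := by
        rw [mem_closedBall_zero_iff] at hyb
        rw [mem_sphere_zero_iff_norm] at hys
        rw [mem_ball_zero_iff]
        exact lt_of_le_of_ne hyb hys
      rw [hy, indicator_of_mem this]
    · rw [interior_closedBall _ ha.ne', closure_ball _ ha.ne']
  have hout : F x = (lam : ℂ) * φ x := by
    refine Measure.eqOn_of_ae_eq (μ := volume) (s := (Metric.ball (0 : Space d) a)ᶜ)
      (f := F) (g := fun x => (lam : ℂ) * φ x) ?_ hF.continuousOn
      (by fun_prop) ?_ (by simp [hx])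
    · refine (ae_restrict_iff' measurableSet_ball.compl).2 ?_
      filter_upwards [h] with y hy hyb
      rw [hy, indicator_of_notMem hyb, mul_zero, add_zero]
    · rw [interior_compl, closure_ball _ ha.ne', closure_compl, interior_closedBall _ ha.ne']
  have hvφ : (v : ℂ) * φ x = 0 := by
    rw [hin] at hout
    simpa using hout
  have hφ0 : φ x = 0 := (mul_eq_zero.1 hvφ).resolve_left (by exact_mod_cast hv)
  exact ⟨hφ0, by rw [hout, hφ0, mul_zero]⟩

/-- Strict maximum principle: where a function of constant phase vanishes, `L_{m,α}` does not,
unless the function is zero, since the heat semigroup is positivity improving. -/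
theorem levyOp_ne_zero {m α γ : ℝ} (hm : 0 ≤ m) (hα0 : 0 < α) (hα2 : α < 2) (hγ : α < γ)
    {φ : Space d → ℂ} (hφ : Continuous φ) (hL2 : MemLp φ 2 volume) (hreg : LocSecondDiff γ φ)
    {c : ℂ} (hc : c ≠ 0) (hphase : ∀ x, φ x = c * ‖φ x‖) (hne : ¬ φ =ᵐ[volume] 0) {x : Space d}
    (hx : φ x = 0) : levyOp m α φ x ≠ 0 := by
  set N : ℝ → ℝ := fun t => ∫ y, heatKernel t (x - y) * ‖φ y‖
  have hheat : ∀ t, heat t φ x = c * N t := fun t => by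
    rw [heat, ← integral_complex_ofReal, ← integral_const_mul]
    congr 1; ext y
    push_cast
    rw [mul_left_comm, ← hphase y]
  have hN : ∀ t, 0 < t → 0 < N t := by
    intro t ht
    have hnn : ∀ y, 0 ≤ heatKernel t (x - y) * ‖φ y‖ := fun y =>
      mul_nonneg (heatKernel_pos ht _).le (norm_nonneg _)
    refine lt_of_le_of_ne (integral_nonneg hnn) fun h0 => hne ?_
    have := (integral_eq_zero_iff_of_nonneg hnn (integrable_heatKernel_mul_norm ht x hL2)).1 h0.symm
    filter_upwards [this] with y hy
    exact norm_eq_zero.1 ((mul_eq_zero.1 hy).resolve_left (heatKernel_pos ht _).ne')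
  have hval : levyOp m α φ x
      = -c * ((∫ t in Ioi (0 : ℝ), levyWeight m α t * N t : ℝ) : ℂ) := by
    rw [levyOp, ← integral_complex_ofReal, ← integral_const_mul]
    congr 1; ext t
    rw [hx, hheat]; push_cast; ring
  have hint : IntegrableOn (fun t => levyWeight m α t * N t) (Ioi 0) := by
    have h1 := (integrableOn_levyOp_integrand (m := m) hm hα0 hα2 hγ hφ hL2 hreg x).const_mul
      (-c)⁻¹
    refine h1.re.congr (Filter.Eventually.of_forall fun t => ?_)
    simp only [hx, hheat, RCLike.re_eq_complex_re]
    have : (-c)⁻¹ * ((levyWeight m α t : ℂ) * (0 - c * (N t : ℂ)))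
        = ((levyWeight m α t * N t : ℝ) : ℂ) := by
      push_cast; field_simp; ring
    rw [this, Complex.ofReal_re]
  have hpos : 0 < ∫ t in Ioi (0 : ℝ), levyWeight m α t * N t := by
    have hp : ∀ t ∈ Ioi (0 : ℝ), 0 < levyWeight m α t * N t := fun t ht =>
      mul_pos (levyWeight_pos hα0 hα2 ht) (hN t ht)
    refine (setIntegral_pos_iff_support_of_nonneg_ae ?_ hint).2 ?_
    · exact (ae_restrict_iff' measurableSet_Ioi).2
        (Filter.Eventually.of_forall fun t ht => (hp t ht).le)
    · have hsub : Ioi (0 : ℝ) ⊆ Function.support fun t => levyWeight m α t * N t :=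
        fun t ht => (hp t ht).ne'
      rw [inter_eq_right.2 hsub]
      simp
  rw [hval]
  exact mul_ne_zero (neg_ne_zero.2 hc) (by exact_mod_cast hpos.ne')

/-- The second differences of a continuous ground state are not locally of order `‖y‖ ^ γ` for any
`γ > α`. The hypothesis `1 ≤ d` provides a point on the sphere. -/
theorem IsGroundState.not_locSecondDiff (hd : 1 ≤ d) {m α v a γ : ℝ} (hm : 0 ≤ m) (hα0 : 0 < α)
    (hα2 : α < 2) (hv : 0 < v) (ha : 0 < a) {φ : Space d → ℂ} (hφ : IsGroundState d m α v a φ)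
    (hc : Continuous φ) (hγ : α < γ) : ¬ LocSecondDiff γ φ := by
  intro hreg
  obtain ⟨lam, ψ, hlam, hne, hψ, hφψ⟩ := hφ
  have hL2 : MemLp φ 2 volume := (memLp_congr_ae hφψ).2 (Lp.memLp _)
  obtain ⟨c, hc1, hphase⟩ :=
    exists_phase_of_apply_eq_smul hm hα0 hα2 hv.le hlam.1 ψ hne hψ hc hφψ
  have hF := levyOp_ae_eq_relOp hm hα0 hα2 hγ hc (ψ : (relOp d m α).domain) hφψ hreg
  have hrel : relOp d m α (ψ : (relOp d m α).domain)
      = (lam : ℂ) • (ψ : L2 d) + (v : ℂ) • ballMul d a (ψ : L2 d) := by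
    rw [← hψ, schroedingerOp_apply]; abel
  have hF' : levyOp m α φ =ᵐ[volume] fun x => (lam : ℂ) * φ x
      + (v : ℂ) * (Metric.ball (0 : Space d) a).indicator φ x := by
    rw [hrel] at hF
    filter_upwards [hF, hφψ, coeFn_ballMul a (ψ : L2 d),
      Lp.coeFn_add ((lam : ℂ) • (ψ : L2 d)) ((v : ℂ) • ballMul d a (ψ : L2 d)),
      Lp.coeFn_smul (lam : ℂ) (ψ : L2 d), Lp.coeFn_smul (v : ℂ) (ballMul d a (ψ : L2 d))]
      with x h1 h2 h3 h4 h5 h6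
    rw [h1, h4, Pi.add_apply, h5, h6, Pi.smul_apply, Pi.smul_apply, h3, smul_eq_mul, smul_eq_mul,
      h2]
    by_cases h : x ∈ Metric.ball (0 : Space d) a
    · rw [indicator_of_mem h, indicator_of_mem h, h2]
    · rw [indicator_of_notMem h, indicator_of_notMem h]
  obtain ⟨x, hx⟩ : ∃ x : Space d, ‖x‖ = a :=
    ⟨EuclideanSpace.single ⟨0, hd⟩ a, by simp [abs_of_pos ha]⟩
  obtain ⟨hx0, hFx⟩ := eq_zero_of_mem_sphere hv.ne' ha
    (continuous_levyOp hm hα0 hα2 hγ hc _ hφψ hreg) hc hF' hx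
  refine levyOp_ne_zero hm hα0 hα2 hγ hc hL2 hreg (c := c) ?_ hphase ?_ hx0 hFx
  · rintro rfl; simp at hc1
  · exact fun h => hne ((Lp.eq_zero_iff_ae_eq_zero).2 (hφψ.symm.trans h))

end RelSchroedinger

theorem theorem5p10 (d : ℕ) (hd : 1 ≤ d) (m α v a : ℝ) (hm : 0 ≤ m) (hα0 : 0 < α) (hα2 : α < 2)
    (hv : 0 < v) (ha : 0 < a) (φ₀ : RelSchroedinger.Space d → ℂ)
    (hφ₀ : RelSchroedinger.IsGroundState d m α v a φ₀) :
    (α < 1 → ∀ δ : ℝ, 0 < δ → δ < 1 - α →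
      ¬ RelSchroedinger.LocHolder (α + δ).toNNReal φ₀) ∧
    (1 ≤ α → ∀ δ : ℝ, 0 < δ → δ < 2 - α →
      ¬ RelSchroedinger.LocC1Holder (α + δ - 1).toNNReal φ₀) := by
  refine ⟨fun _ δ hδ _ h => ?_, fun hα1 δ hδ _ h => ?_⟩
  · refine hφ₀.not_locSecondDiff hd hm hα0 hα2 hv ha
      (h.continuous (Real.toNNReal_pos.2 (by linarith))) ?_ h.locSecondDiff
    rw [Real.coe_toNNReal _ (by linarith)]
    linarith
  · refine hφ₀.not_locSecondDiff hd hm hα0 hα2 hv ha h.1.continuous ?_ h.locSecondDiff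
    rw [Real.coe_toNNReal _ (by linarith)]
    linarith
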